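/- Let $p$ be a prime and let $(A,\mathfrak m)$ be a Noetherian Cohen--Macaulay local ring of characteristic $p$ and dimension $d\ge 1$. Let $I$ be an $\mathfrak m$-primary ideal of $A$, and let $J$ be a minimal reduction of $I$, that is, an ideal that is minimal under inclusion among the ideals $K\subseteq I$ with $I^{n+1}=KI^n$ for some $n\ge 0$. Suppose that the residue field $A/\mathfrak m$ is infinite or, more generally, that $J$ is generated by $d$ elements, and suppose that $I^2\subseteq J$. For $q=p^e$ let $I^{[q]}$ be the ideal generated by all $a^q$ with $a\in I$. Then the limits $$\mathrm e(I)=\lim_{n\to\infty}\frac{d!}{n^d}\,\ell_A(A/I^{n+1}),\qquad \mathrm e_{HK}(I)=\lim_{e\to\infty}\frac{\ell_A(A/I^{[p^e]})}{p^{ed}}$$ exist (the multiplicity and the Hilbert--Kunz multiplicity of $I$), and $$\mathrm e_{HK}(I)\ \ge\ \frac{\mathrm e(I)}{2}.$$ -/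

import Mathlib

open Filter Topology

universe u

noncomputable section

/-- A (Noetherian) local ring is Cohen–Macaulay if its maximal ideal contains an `A`-regular
sequence whose length is the Krull dimension of `A`. -/
def IsCohenMacaulayLocal (A : Type u) [CommRing A] [IsLocalRing A] : Prop :=
  ∃ rs : List A, (∀ r ∈ rs, r ∈ IsLocalRing.maximalIdeal A) ∧
    RingTheory.Sequence.IsRegular A rs ∧ ringKrullDim A = (rs.length : WithBot ℕ∞)

/-- `J` is a reduction of `I`: `J ⊆ I` and `I ^ (n + 1) = J I ^ n` for some `n ≥ 0`. -/
def IsReduction {A : Type u} [CommRing A] (J I : Ideal A) : Prop :=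
  J ≤ I ∧ ∃ n : ℕ, I ^ (n + 1) = J * I ^ n

/-- `J` is a minimal reduction of `I`: it is minimal under inclusion among the reductions
of `I`. -/
def IsMinimalReduction {A : Type u} [CommRing A] (J I : Ideal A) : Prop :=
  Minimal (fun K : Ideal A => IsReduction K I) J

/-- The ideal `I^{[q]}` generated by the `q`-th powers of the elements of `I`. -/
def frobeniusPower {A : Type u} [CommRing A] (I : Ideal A) (q : ℕ) : Ideal A :=
  Ideal.span ((fun a : A => a ^ q) '' (I : Set A))

/-- The length of `A / I` as a real number (used only for ideals of finite colength). -/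
def colength {A : Type u} [CommRing A] (I : Ideal A) : ℝ :=
  ((Module.length A (A ⧸ I)).toNat : ℝ)

/-- The sequence `d! ℓ(A / I ^ (n + 1)) / n ^ d`, whose limit is `e(I)` when `dim A = d`. -/
def multiplicitySeq {A : Type u} [CommRing A] (d : ℕ) (I : Ideal A) (n : ℕ) : ℝ :=
  (Nat.factorial d : ℝ) / (n : ℝ) ^ d * colength (I ^ (n + 1))

/-- The sequence `ℓ(A / I^{[q]}) / q ^ d`, `q = p ^ e`, whose limit is `e_HK(I)` when
`dim A = d`. -/
def hilbertKunzSeq {A : Type u} [CommRing A] (p d : ℕ) (I : Ideal A) (e : ℕ) : ℝ :=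
  colength (frobeniusPower I (p ^ e)) / ((p ^ e : ℕ) : ℝ) ^ d

/-- The multiplicity `e(I)` of an ideal in a local ring of dimension `d`. -/
def idealMultiplicity {A : Type u} [CommRing A] (d : ℕ) (I : Ideal A) : ℝ :=
  limUnder atTop (multiplicitySeq d I)

/-- The Hilbert–Kunz multiplicity `e_HK(I)` of an ideal in a local ring of dimension `d` and
characteristic `p`. -/
def hilbertKunzMultiplicity {A : Type u} [CommRing A] (p d : ℕ) (I : Ideal A) : ℝ :=
  limUnder atTop (hilbertKunzSeq p d I)

end

/-! Let J = (x_1, …, x_d) and q = p^e. Since A is Cohen–Macaulay, e(I) = ℓ(A/J) and ℓ(A/J^{[q]}) =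
q^d ℓ(A/J), so it suffices to show ℓ(A/J^{[q]}) ≤ 2 ℓ(A/I^{[q]}) + O(q^{d-1}). From I² ⊆ J one gets
I^{[q]} · I^{[q]} ⊆ J^{[q]}. If A were Gorenstein, A/J^{[q]} would carry a perfect form β with β(ar,
t) = β(r, at); then I^{[q]}/J^{[q]} would be isotropic, hence at most half of the space. In general
there is such a form generically, balanced only for multiplication by q-th powers, and that is
enough.

The completion R of A has a coefficient field k, and X_i ↦ x_i makes R free of rank ℓ(A/J) over P =
k[[X_1, …, X_d]] (`AdicCompletion.exists_algebra_mvPowerSeries`). Let K = Frac P. The subalgebras of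
K ⊗ R generated by the p^s-th powers decrease, hence stabilise. The stable one, B, is spanned over K
by its own p-th powers; therefore it is reduced, a product of fields, and K ⊗ R is a direct sum of
residue fields of B. Such a sum carries a nondegenerate B-balanced form β and a Frobenius-semilinear
map ψ whose image spans (`exists_frobenius_and_form`). Clearing denominators puts both on R at the
price of nonzero elements δ of P (`exists_integral_frobenius_and_form`), which cost only dim P/(δ,
X_1^q, …, X_d^q) = O(q^{d-1}) (`MvPowerSeries.exists_finrank_quotient_sup_le`).

The form yields the lower bound (`card_mul_pow_le_finrank_quotient_powSpan`). The map ψ sends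
I^{[q]}R into I^{[pq]}R and yields ℓ(A/I^{[pq]}) ≤ p^d ℓ(A/I^{[q]}) + O(q^{d-1})
(`finrank_quotient_powSpan_mul_le`), so the Hilbert–Kunz limit exists, with no finiteness of k over
its p-th powers.

That J has d generators when the residue field is infinite is the Northcott–Rees argument: with more
than d generators the growth of ℓ(A/J^n) forces a relation among their monomials, and this produces
a reduction with one generator fewer (`IsMinimalReduction.exists_eq_span_range`). -/

/-- The subalgebra generated by the `p ^ s`-th powers. -/
def powAdjoin (K : Type*) [Field K] (p : ℕ) (A : Type*) [CommRing A] [Algebra K A] (s : ℕ) :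
    Subalgebra K A :=
  Algebra.adjoin K (Set.range fun a : A => a ^ p ^ s)

/-- The `p ^ s`-th powers are closed under multiplication, so no products need to be adjoined. -/
theorem powAdjoin_toSubmodule {K : Type*} [Field K] (p : ℕ) (A : Type*) [CommRing A] [Algebra K A] (s : ℕ) :
    Subalgebra.toSubmodule (powAdjoin K p A s) =
      Submodule.span K (Set.range fun a : A => a ^ p ^ s) := by
  have h : (Set.range fun a : A => a ^ p ^ s) =
      (MonoidHom.mrange (powMonoidHom (α := A) (p ^ s)) : Set A) := by
    ext; simp
  rw [powAdjoin, Algebra.adjoin_eq_span, h, Submonoid.closure_eq]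

/-! ### Finite-dimensional algebras spanned by their p-th powers. -/

section FrobeniusSpan

variable {K : Type*} [Field K] (p : ℕ) [Fact p.Prime]

/-- The p-th powers of the members of a basis span, hence by counting again form a basis. A nonzero
`b` belongs to some basis, so `b ^ p ≠ 0`. -/
theorem isReduced_of_span_range_pow_eq_top {B : Type*} [CommRing B] [Algebra K B]
    [FiniteDimensional K B] [CharP B p]
    (h : Submodule.span K (Set.range fun b : B => b ^ p) = ⊤) : IsReduced B := by
  have key : ∀ b : B, b ^ p = 0 → b = 0 := by
    intro b hb
    by_contra hb0
    have hs : LinearIndepOn K id ({b} : Set B) := LinearIndepOn.singleton hb0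
    let v := Module.Basis.extend hs
    let w := fun i => (v i) ^ p
    have hfin : Fintype (hs.extend (Set.subset_univ ({b} : Set B))) :=
      FiniteDimensional.fintypeBasisIndex v
    have hw : ⊤ ≤ Submodule.span K (Set.range w) := by
      rw [← h, Submodule.span_le]
      rintro _ ⟨c, rfl⟩
      simp only [SetLike.mem_coe]
      rw [← v.sum_repr c, sum_pow_char]
      refine Submodule.sum_mem _ fun i _ => ?_
      rw [smul_pow]
      exact Submodule.smul_mem _ _ (Submodule.subset_span ⟨i, rfl⟩)
    have hli := linearIndependent_of_top_le_span_of_card_eq_finrank hw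
      (Module.finrank_eq_card_basis v).symm
    have hmem : b ∈ hs.extend (Set.subset_univ ({b} : Set B)) :=
      hs.subset_extend _ (Set.mem_singleton b)
    refine hli.ne_zero ⟨b, hmem⟩ ?_
    simp only [w, v]
    rw [Module.Basis.extend_apply_self]
    exact hb
  refine ⟨fun b hb => ?_⟩
  obtain ⟨n, hn⟩ := hb
  have hn' : ∀ m : ℕ, b ^ p ^ m = 0 → b = 0 := by
    intro m
    induction m with
    | zero => simp
    | succ m ih => exact fun hm => ih (key _ (by rw [← pow_mul, ← pow_succ]; exact hm))
  exact hn' n (pow_eq_zero_of_le (Nat.lt_pow_self (Fact.out : p.Prime).one_lt).le hn)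

/-- A finite module over a reduced finite-dimensional algebra is isomorphic to a finite product
of residue fields. -/
theorem exists_linearEquiv_pi_quotient_maximal {B : Type*} [CommRing B] [IsArtinianRing B]
    [IsReduced B] (M : Type*) [AddCommGroup M] [Module B M] [Module.Finite B M] :
    ∃ (n : ℕ) (I : Fin n → Ideal B), (∀ i, (I i).IsMaximal) ∧
      Nonempty (M ≃ₗ[B] (∀ i, B ⧸ I i)) := by
  have : IsSemisimpleRing B := IsArtinianRing.isSemisimpleRing_of_isReduced B
  obtain ⟨n, S, e, hS⟩ := IsSemisimpleModule.exists_linearEquiv_fin_dfinsupp B M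
  have h : ∀ i, ∃ I : Ideal B, I.IsMaximal ∧ Nonempty ((S i) ≃ₗ[B] B ⧸ I) := fun i =>
    isSimpleModule_iff_quot_maximal.mp (hS i)
  choose I hI hSI using h
  exact ⟨n, I, hI, ⟨(e.trans DFinsupp.linearEquivFunOnFintype).trans
    (LinearEquiv.piCongrRight fun i => (hSI i).some)⟩⟩

variable {B : Type*} [CommRing B] [Algebra K B] [FiniteDimensional K B] [CharP B p]

/-- On a direct sum of residue fields of `B`, take the p-th power in each coordinate. Its image
spans because the p-th powers span `B`, hence each quotient of `B`. -/
theorem exists_frobenius_semilinear (h : Submodule.span K (Set.range fun b : B => b ^ p) = ⊤)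
    (M : Type*) [AddCommGroup M] [Module B M] [Module K M] [IsScalarTower K B M]
    [Module.Finite B M] :
    ∃ ψ : M →+ M, (∀ (b : B) (m : M), ψ (b • m) = b ^ p • ψ m) ∧
      Submodule.span K (Set.range ψ) = ⊤ := by
  have := isReduced_of_span_range_pow_eq_top p h
  have : IsArtinianRing B := IsArtinianRing.of_finite K B
  obtain ⟨n, I, hI, ⟨e⟩⟩ := exists_linearEquiv_pi_quotient_maximal (B := B) M
  have hchar : ∀ i, CharP (B ⧸ I i) p := fun i =>
    have := Ideal.Quotient.nontrivial_iff.mpr (hI i).ne_top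
    (CharP.charP_iff_prime_eq_zero Fact.out).mpr (by
      rw [← map_natCast (Ideal.Quotient.mk (I i)), CharP.cast_eq_zero, map_zero])
  let ψ₀ : (∀ i, B ⧸ I i) →+ (∀ i, B ⧸ I i) :=
    { toFun := fun f i => f i ^ p
      map_zero' := by ext i; simp [(Fact.out : p.Prime).ne_zero]
      map_add' := fun f g => by ext i; simp only [Pi.add_apply]; rw [add_pow_char] }
  refine ⟨(e.symm : _ →+ M).comp (ψ₀.comp (e : M →+ _)), ?_, ?_⟩
  · intro b m
    simp only [AddMonoidHom.comp_apply]
    change e.symm (ψ₀ (e (b • m))) = b ^ p • e.symm (ψ₀ (e m))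
    rw [map_smul, ← map_smul e.symm]
    congr 1
    ext i
    change (b • e m i) ^ p = b ^ p • (e m i) ^ p
    rw [smul_pow]
  · have hrange : ∀ f, e.symm (ψ₀ f) ∈ Submodule.span K
        (Set.range ((e.symm : _ →+ M).comp (ψ₀.comp (e : M →+ _)))) := fun f =>
      Submodule.subset_span ⟨e.symm f, by
        change e.symm (ψ₀ (e (e.symm f))) = _
        rw [LinearEquiv.apply_symm_apply]⟩
    rw [eq_top_iff]
    rintro m -
    obtain ⟨f, rfl⟩ := e.symm.surjective m
    rw [← Finset.univ_sum_single f, map_sum]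
    refine Submodule.sum_mem _ fun i _ => ?_
    obtain ⟨b, hb⟩ := Ideal.Quotient.mk_surjective (f i)
    rw [← hb]
    have hb' : b ∈ Submodule.span K (Set.range fun b : B => b ^ p) := h ▸ Submodule.mem_top
    clear hb
    induction hb' using Submodule.span_induction with
    | mem x hx =>
      obtain ⟨c, rfl⟩ := hx
      convert! hrange (Pi.single i (Ideal.Quotient.mk (I i) c)) using 2
      ext j
      change _ = (Pi.single i (Ideal.Quotient.mk (I i) c) : ∀ i, B ⧸ I i) j ^ p
      by_cases hij : j = i
      · subst hij; simp
      · simp [hij, (Fact.out : p.Prime).ne_zero]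
    | zero => simp
    | add x y _ _ hx hy => rw [map_add, Pi.single_add, map_add]; exact add_mem hx hy
    | smul c x _ hx =>
      have : (Pi.single i (Ideal.Quotient.mk (I i) (c • x)) : ∀ i, B ⧸ I i) =
          (algebraMap K B c) • Pi.single i (Ideal.Quotient.mk (I i) x) := by
        rw [← Pi.single_smul, Algebra.smul_def]
        rfl
      rw [this, map_smul, algebraMap_smul]
      exact Submodule.smul_mem _ _ hx

/-- On a direct sum of residue fields, take the sum of the forms `l (f * g)`, where `l` is a
functional with `l 1 = 1` on each field. Nondegeneracy comes from inverting a nonzero coordinate. -/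
theorem exists_nondegenerate_balanced_form
    (M : Type*) [AddCommGroup M] [Module B M] [Module K M] [IsScalarTower K B M]
    [Module.Finite B M] [IsReduced B] :
    ∃ β : M →ₗ[K] M →ₗ[K] K, (∀ (b : B) (m m' : M), β (b • m) m' = β m (b • m')) ∧
      ∀ m, (∀ m', β m m' = 0) → m = 0 := by
  have : IsArtinianRing B := IsArtinianRing.of_finite K B
  obtain ⟨n, I, hI, ⟨e⟩⟩ := exists_linearEquiv_pi_quotient_maximal (B := B) M
  have hl : ∀ i, ∃ l : Module.Dual K (B ⧸ I i), l 1 = 1 := fun i =>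
    have := Ideal.Quotient.nontrivial_iff.mpr (hI i).ne_top
    Module.Projective.exists_dual_eq_one K one_ne_zero
  choose l hl using hl
  let eK : M →ₗ[K] (∀ i, B ⧸ I i) := (e : M →ₗ[B] _).restrictScalars K
  let β₀ : (∀ i, B ⧸ I i) →ₗ[K] (∀ i, B ⧸ I i) →ₗ[K] K :=
    ∑ i, ((LinearMap.mul K (B ⧸ I i)).compr₂ (l i)).compl₁₂ (LinearMap.proj i) (LinearMap.proj i)
  have hβ₀ : ∀ f g, β₀ f g = ∑ i, l i (f i * g i) := fun f g => by
    simp [β₀, LinearMap.sum_apply]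
  refine ⟨β₀.compl₁₂ eK eK, ?_, ?_⟩
  · intro b m m'
    change β₀ (e (b • m)) (e m') = β₀ (e m) (e (b • m'))
    rw [hβ₀, hβ₀, map_smul, map_smul]
    refine Finset.sum_congr rfl fun i _ => ?_
    simp
  · intro m hm
    rw [← e.map_eq_zero_iff]
    ext i
    by_contra hi
    obtain ⟨y, hy⟩ := (Ideal.Quotient.maximal_ideal_iff_isField_quotient _).mp (hI i) |>.mul_inv_cancel hi
    have h := hm (e.symm (Pi.single i y))
    change β₀ (e m) (e (e.symm (Pi.single i y))) = 0 at h
    rw [e.apply_symm_apply, hβ₀, Finset.sum_eq_single i] at h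
    · rw [Pi.single_eq_same, hy, hl] at h
      exact one_ne_zero h
    · intro j _ hj
      simp [Pi.single_eq_of_ne hj]
    · simp

-- The algebra `A` may be neither reduced nor self-dual. As a module over its stable subalgebra of
-- `p ^ s`-th powers it is semisimple, and both structures come from there.
variable (K) in
theorem exists_frobenius_and_form (A : Type*) [CommRing A] [Algebra K A] [FiniteDimensional K A]
    [CharP A p] :
    ∃ s : ℕ, (∃ ψ : A →+ A, (∀ (c : K) (r : A), ψ (c • r) = c ^ p • ψ r) ∧
        (∀ a r : A, ψ (a ^ p ^ s * r) = a ^ p ^ (s + 1) * ψ r) ∧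
        Submodule.span K (Set.range ψ) = ⊤) ∧
      ∃ β : A →ₗ[K] A →ₗ[K] K, (∀ a r t : A, β (a ^ p ^ s * r) t = β r (a ^ p ^ s * t)) ∧
        ∀ r, (∀ t, β r t = 0) → r = 0 := by
  have hanti : Antitone fun s => Subalgebra.toSubmodule (powAdjoin K p A s) := by
    refine antitone_nat_of_succ_le fun s => ?_
    rw [powAdjoin_toSubmodule, powAdjoin_toSubmodule]
    refine Submodule.span_mono ?_
    rintro _ ⟨a, rfl⟩
    exact ⟨a ^ p, by simp only [← pow_mul, pow_succ']⟩
  obtain ⟨s, hs⟩ := IsArtinian.monotone_stabilizes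
    (⟨fun s => OrderDual.toDual (Subalgebra.toSubmodule (powAdjoin K p A s)), hanti⟩ :
      ℕ →o (Submodule K A)ᵒᵈ)
  replace hs : Subalgebra.toSubmodule (powAdjoin K p A s) =
      Subalgebra.toSubmodule (powAdjoin K p A (s + 1)) := hs (s + 1) (Nat.le_succ s)
  let B := powAdjoin K p A s
  have hmem : ∀ a : A, a ^ p ^ s ∈ B := fun a => Algebra.subset_adjoin ⟨a, rfl⟩
  -- The p-th powers of the elements `a ^ p ^ s` of `B` span the next subalgebra of the chain, which
  -- equals `B`.
  have hB : Submodule.span K (Set.range fun b : B => b ^ p) = ⊤ := by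
    apply Submodule.map_injective_of_injective (f := B.val.toLinearMap) Subtype.val_injective
    rw [Submodule.map_span, Submodule.map_top]
    have hr : LinearMap.range B.val.toLinearMap = Subalgebra.toSubmodule B := by
      ext; simp
    rw [hr]
    apply le_antisymm
    · rw [Submodule.span_le]
      rintro _ ⟨_, ⟨b, rfl⟩, rfl⟩
      exact (b ^ p).2
    · rw [hs, powAdjoin_toSubmodule]
      refine Submodule.span_mono ?_
      rintro _ ⟨a, rfl⟩
      exact ⟨_, ⟨⟨a ^ p ^ s, hmem a⟩, rfl⟩, by simp [← pow_mul, pow_succ]⟩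
  have : CharP B p := (RingHom.charP_iff B.val.toRingHom Subtype.val_injective p).mpr inferInstance
  have := isReduced_of_span_range_pow_eq_top p hB
  have : Module.Finite B A := Module.Finite.of_restrictScalars_finite K B A
  obtain ⟨ψ, hψ, hspan⟩ := exists_frobenius_semilinear p hB A
  obtain ⟨β, hβ, hnd⟩ := exists_nondegenerate_balanced_form (K := K) (B := B) A
  refine ⟨s, ⟨ψ, fun c r => ?_, fun a r => ?_, hspan⟩, β, fun a r t => ?_, hnd⟩
  · have := hψ (algebraMap K B c) r
    rwa [algebraMap_smul, ← map_pow, algebraMap_smul] at this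
  · rw [pow_succ, pow_mul]
    exact hψ ⟨_, hmem a⟩ r
  · exact hβ ⟨_, hmem a⟩ r t

end FrobeniusSpan

/-! ### A dimension count for nested subspaces. -/

section LinearAlgebra

theorem finrank_quotient_add_le {k V E : Type*} [Field k] [AddCommGroup V] [Module k V]
    [AddCommGroup E] [Module k E] {N I : Submodule k V} (hNI : N ≤ I)
    [FiniteDimensional k (V ⧸ N)] (f : E →ₗ[k] V) (hfI : ∀ x, f x ∈ I)
    (hfN : ∀ x, f x ∈ N → x = 0) :
    Module.finrank k (V ⧸ I) + Module.finrank k E ≤ Module.finrank k (V ⧸ N) := by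
  let π : (V ⧸ N) →ₗ[k] (V ⧸ I) := Submodule.factor hNI
  have hπ : Function.Surjective π := Submodule.factor_surjective hNI
  let g : E →ₗ[k] LinearMap.ker π := LinearMap.codRestrict _ (N.mkQ ∘ₗ f) fun x => by
    simpa [π] using hfI x
  have hg : Function.Injective g := by
    rw [injective_iff_map_eq_zero]
    intro x hx
    apply hfN
    have := congrArg Subtype.val hx
    simpa [g] using this
  have h1 := LinearMap.finrank_range_add_finrank_ker π
  rw [LinearMap.range_eq_top.mpr hπ, finrank_top] at h1
  have h2 := LinearMap.finrank_le_finrank_of_injective hg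
  omega

end LinearAlgebra

/-! ### Monomial ideals in power series rings and their colengths. -/

namespace MvPowerSeries

variable {σ k : Type*}

section Monomial

variable [CommRing k]

/-- The power series with given coefficients. -/
def ofCoeff (g : (σ →₀ ℕ) → k) : MvPowerSeries σ k := g

@[simp]
theorem coeff_ofCoeff (g : (σ →₀ ℕ) → k) (α : σ →₀ ℕ) : coeff α (ofCoeff g) = g α := rfl

theorem mem_span_monomial_iff (T : Finset (σ →₀ ℕ)) (f : MvPowerSeries σ k) :
    f ∈ Ideal.span ((fun t => monomial t (1 : k)) '' (T : Set (σ →₀ ℕ))) ↔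
      ∀ α, coeff α f ≠ 0 → ∃ t ∈ T, t ≤ α := by
  classical
  constructor
  · intro hf
    induction hf using Submodule.span_induction with
    | mem x hx =>
      obtain ⟨t, ht, rfl⟩ := hx
      intro α hα
      rw [coeff_monomial] at hα
      have : α = t := by
        by_contra h
        simp [h] at hα
      exact ⟨t, ht, this.ge⟩
    | zero => simp
    | add x y _ _ hx hy =>
      intro α hα
      by_cases h : coeff α x = 0
      · exact hy α (by simpa [h] using hα)
      · exact hx α h
    | smul c x _ hx =>
      intro α hα
      rw [smul_eq_mul, coeff_mul] at hα
      obtain ⟨⟨a, b⟩, hab, h⟩ := Finset.exists_ne_zero_of_sum_ne_zero hα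
      obtain ⟨t, ht, htb⟩ := hx b (right_ne_zero_of_mul h)
      rw [Finset.HasAntidiagonal.mem_antidiagonal] at hab
      exact ⟨t, ht, htb.trans (hab ▸ le_add_self)⟩
  · intro h
    -- `τ` selects one generator dividing each monomial of `f`. Sorting the monomials by the
    -- selected generator writes `f` as a finite combination of the generators.
    let τ : (σ →₀ ℕ) → (σ →₀ ℕ) := fun α => if h : ∃ t ∈ T, t ≤ α then h.choose else 0
    have hτ : ∀ α, coeff α f ≠ 0 → τ α ∈ T ∧ τ α ≤ α := fun α hα => by
      simp only [τ, dif_pos (h α hα)]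
      exact (h α hα).choose_spec
    have hf : f = ∑ t ∈ T, monomial t (1 : k) *
        ofCoeff fun β => if τ (t + β) = t then coeff (t + β) f else 0 := by
      ext α
      rw [map_sum]
      simp only [coeff_monomial_mul, one_mul, coeff_ofCoeff]
      have hterm : ∀ t ∈ T, (if t ≤ α then (if τ (t + (α - t)) = t then
          coeff (t + (α - t)) f else 0) else 0) = if τ α = t then coeff α f else 0 := by
        intro t _
        by_cases h1 : t ≤ α
        · rw [if_pos h1, add_tsub_cancel_of_le h1]
        · rw [if_neg h1]
          by_cases hα : coeff α f = 0
          · simp [hα]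
          · rw [if_neg fun h2 : τ α = t => h1 (h2 ▸ (hτ α hα).2)]
      rw [Finset.sum_congr rfl hterm, Finset.sum_ite_eq]
      split_ifs with h3
      · rfl
      · by_contra h4
        exact h3 (hτ α h4).1
    rw [hf]
    exact Ideal.sum_mem _ fun t ht => Ideal.mul_mem_right _ _ (Ideal.subset_span ⟨t, ht, rfl⟩)

/-- The coefficients of a power series with exponents in `G`. -/
def coeffs (k : Type*) [CommRing k] (G : Set (σ →₀ ℕ)) : MvPowerSeries σ k →ₗ[k] (G → k) :=
  LinearMap.pi fun α => coeff α.1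

theorem coeffs_surjective (G : Set (σ →₀ ℕ)) : Function.Surjective (coeffs k G) := by
  classical
  intro g
  refine ⟨ofCoeff fun α => if h : α ∈ G then g ⟨α, h⟩ else 0, ?_⟩
  ext α
  simp [coeffs]

end Monomial

section Field

variable [Field k]

/-- The monomials outside a monomial ideal form a basis of the quotient. -/
noncomputable def quotientEquivCoeffs (I : Ideal (MvPowerSeries σ k)) (G : Set (σ →₀ ℕ))
    (h : ∀ f, f ∈ I ↔ ∀ α ∈ G, coeff α f = 0) : (MvPowerSeries σ k ⧸ I) ≃ₗ[k] (G → k) :=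
  (Submodule.Quotient.restrictScalarsEquiv k I).symm ≪≫ₗ
    Submodule.quotEquivOfEq _ _ (by
      ext f
      simp [h, coeffs, funext_iff]) ≪≫ₗ
    (coeffs k G).quotKerEquivOfSurjective (coeffs_surjective G)

theorem finrank_quotient_eq_card (I : Ideal (MvPowerSeries σ k)) (G : Set (σ →₀ ℕ)) [Finite G]
    (h : ∀ f, f ∈ I ↔ ∀ α ∈ G, coeff α f = 0) :
    Module.finrank k (MvPowerSeries σ k ⧸ I) = Nat.card G := by
  have := Fintype.ofFinite G
  rw [(quotientEquivCoeffs I G h).finrank_eq, Module.finrank_fintype_fun_eq_card,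
    Nat.card_eq_fintype_card]

theorem finiteDimensional_quotient (I : Ideal (MvPowerSeries σ k)) (G : Set (σ →₀ ℕ)) [Finite G]
    (h : ∀ f, f ∈ I ↔ ∀ α ∈ G, coeff α f = 0) :
    FiniteDimensional k (MvPowerSeries σ k ⧸ I) :=
  Module.Finite.equiv (quotientEquivCoeffs I G h).symm

end Field

section Box

variable {d : ℕ} [Field k]

/-- The exponents bounded strictly by `a`. -/
def box (a : Fin d → ℕ) : Set (Fin d →₀ ℕ) := {α | ∀ i, α i < a i}

/-- Exponents in a box are tuples. -/
noncomputable def boxEquiv (a : Fin d → ℕ) : box a ≃ ∀ i, Fin (a i) where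
  toFun α i := ⟨α.1 i, α.2 i⟩
  invFun f := ⟨Finsupp.equivFunOnFinite.symm fun i => (f i : ℕ), fun i => by simp⟩
  left_inv α := by ext; simp
  right_inv f := by ext; simp

instance (a : Fin d → ℕ) : Finite (box a) := Finite.of_equiv _ (boxEquiv a).symm

theorem card_box (a : Fin d → ℕ) : Nat.card (box a) = ∏ i, a i := by
  rw [Nat.card_congr (boxEquiv a), Nat.card_pi]
  simp

/-- The ideal generated by the `q`-th powers of the variables. -/
noncomputable def varPow (k : Type*) [Field k] (d q : ℕ) : Ideal (MvPowerSeries (Fin d) k) :=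
  Ideal.span (Set.range fun i => (X i : MvPowerSeries (Fin d) k) ^ q)

theorem mem_varPow_iff {q : ℕ} (f : MvPowerSeries (Fin d) k) :
    f ∈ varPow k d q ↔ ∀ α ∈ box (fun _ : Fin d => q), coeff α f = 0 := by
  classical
  have h : (Set.range fun i => (X i : MvPowerSeries (Fin d) k) ^ q) =
      (fun t => monomial t (1 : k)) ''
        ((Finset.univ.image fun i : Fin d => Finsupp.single i q : Finset (Fin d →₀ ℕ)) : Set _) := by
    ext f
    simp [X_pow_eq]
  rw [varPow, h, mem_span_monomial_iff]
  refine forall_congr' fun α => ?_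
  rw [← not_imp_not, not_not]
  refine imp_congr ?_ Iff.rfl
  simp [box]

theorem finrank_quotient_varPow (q : ℕ) :
    Module.finrank k (MvPowerSeries (Fin d) k ⧸ varPow k d q) = q ^ d := by
  rw [finrank_quotient_eq_card _ _ mem_varPow_iff, card_box]
  simp

instance (q : ℕ) : FiniteDimensional k (MvPowerSeries (Fin d) k ⧸ varPow k d q) :=
  finiteDimensional_quotient _ _ mem_varPow_iff

/-- Multiply the inequality for `s` by `q ≤ (q - a j) + a j`, which holds for truncated subtraction
too, and bound the product by `q ^ s.card`. -/
theorem pow_le_prod_sub_add {ι : Type*} (s : Finset ι) (a : ι → ℕ) (q : ℕ) :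
    q ^ s.card ≤ ∏ i ∈ s, (q - a i) + (∑ i ∈ s, a i) * q ^ (s.card - 1) := by
  classical
  induction s using Finset.induction_on with
  | empty => simp
  | insert j s hj ih =>
    rw [Finset.card_insert_of_notMem hj, Finset.prod_insert hj, Finset.sum_insert hj,
      Nat.add_sub_cancel]
    have h1 : ∏ i ∈ s, (q - a i) ≤ q ^ s.card := by
      rw [← Finset.prod_const]
      exact Finset.prod_le_prod' fun i _ => Nat.sub_le _ _
    have h2 : q * ((∑ i ∈ s, a i) * q ^ (s.card - 1)) = (∑ i ∈ s, a i) * q ^ s.card := by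
      rcases s.eq_empty_or_nonempty with rfl | hs
      · simp
      · obtain ⟨n, hn⟩ := Nat.exists_eq_succ_of_ne_zero hs.card_ne_zero
        rw [hn, Nat.succ_eq_add_one, Nat.add_sub_cancel, pow_succ]
        ring
    have h3 : q ≤ (q - a j) + a j := by omega
    calc q ^ (s.card + 1) = q * q ^ s.card := pow_succ' _ _
      _ ≤ q * (∏ i ∈ s, (q - a i) + (∑ i ∈ s, a i) * q ^ (s.card - 1)) := by gcongr
      _ = q * ∏ i ∈ s, (q - a i) + (∑ i ∈ s, a i) * q ^ s.card := by rw [mul_add, h2]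
      _ ≤ ((q - a j) + a j) * ∏ i ∈ s, (q - a i) + (∑ i ∈ s, a i) * q ^ s.card := by gcongr
      _ = (q - a j) * ∏ i ∈ s, (q - a i) + a j * ∏ i ∈ s, (q - a i) +
          (∑ i ∈ s, a i) * q ^ s.card := by ring
      _ ≤ (q - a j) * ∏ i ∈ s, (q - a i) + a j * q ^ s.card +
          (∑ i ∈ s, a i) * q ^ s.card := by gcongr
      _ = _ := by ring

/-- Modulo a nonzero element, the box quotients have smaller growth. -/
theorem exists_finrank_quotient_sup_le (δ : MvPowerSeries (Fin d) k) (hδ : δ ≠ 0) :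
    ∃ C : ℕ, ∀ q, Module.finrank k
      (MvPowerSeries (Fin d) k ⧸ (Ideal.span {δ} ⊔ varPow k d q)) ≤ C * q ^ (d - 1) := by
  classical
  obtain ⟨α, hα⟩ := exists_finsupp_eq_lexOrder_of_ne_zero hδ
  refine ⟨∑ i, α i, fun q => ?_⟩
  -- With `α` the lexicographic leading exponent of `δ`, a nonzero series supported in `W` times `δ`
  -- has its leading exponent in the box of side `q`. So `f` embeds a space of dimension `∏ (q - α
  -- i)` into `(δ) + varPow` modulo `varPow`.
  let W : Set (Fin d →₀ ℕ) := box fun i => q - α i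
  have := Fintype.ofFinite W
  let f : (W → k) →ₗ[k] MvPowerSeries (Fin d) k :=
    { toFun := fun g => δ * ofCoeff fun β => if h : β ∈ W then g ⟨β, h⟩ else 0
      map_add' := fun g h => by
        rw [← mul_add]
        congr 1
        ext β
        simp only [coeff_ofCoeff, map_add]
        split_ifs <;> simp
      map_smul' := fun c g => by
        rw [RingHom.id_apply, ← mul_smul_comm]
        congr 1
        ext β
        simp only [coeff_ofCoeff, coeff_smul]
        split_ifs <;> simp }
  have : FiniteDimensional k (MvPowerSeries (Fin d) k ⧸ (varPow k d q).restrictScalars k) :=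
    inferInstanceAs (FiniteDimensional k (MvPowerSeries (Fin d) k ⧸ varPow k d q))
  have hle := finrank_quotient_add_le (k := k) (V := MvPowerSeries (Fin d) k)
    (N := (varPow k d q).restrictScalars k)
    (I := (Ideal.span {δ} ⊔ varPow k d q).restrictScalars k)
    (le_sup_right (a := Ideal.span {δ}) (b := varPow k d q)) f
    (fun g => Ideal.mem_sup_left (Ideal.mul_mem_right _ _ (Ideal.mem_span_singleton_self δ)))
    (fun g hg => by
      by_contra hg0
      let G : MvPowerSeries (Fin d) k := ofCoeff fun β => if h : β ∈ W then g ⟨β, h⟩ else 0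
      have hG : G ≠ 0 := by
        obtain ⟨β, hβ⟩ := Function.ne_iff.mp hg0
        intro h
        apply hβ
        have : coeff β.1 G = 0 := by rw [h]; simp
        simpa [G] using this
      obtain ⟨β, hβ⟩ := exists_finsupp_eq_lexOrder_of_ne_zero hG
      have hβW : β ∈ W := by
        have := coeff_ne_zero_of_lexOrder hβ.symm
        by_contra h
        simp [G, h] at this
      have hord : toLex (α + β) = lexOrder (δ * G) := by
        rw [lexOrder_mul, hα, hβ]
        rfl
      refine coeff_ne_zero_of_lexOrder hord ?_
      refine (mem_varPow_iff (k := k) (δ * G)).mp hg _ fun i => ?_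
      have : β i < q - α i := hβW i
      simp only [Finsupp.add_apply]
      omega)
  have h1 : Module.finrank k (MvPowerSeries (Fin d) k ⧸ (varPow k d q).restrictScalars k) =
      q ^ d := finrank_quotient_varPow q
  have h2 : Module.finrank k (W → k) = ∏ i, (q - α i) := by
    rw [Module.finrank_fintype_fun_eq_card, ← Nat.card_eq_fintype_card, card_box]
  have h3 := pow_le_prod_sub_add Finset.univ (fun i => α i) q
  rw [Finset.card_fin] at h3
  rw [h1, h2] at hle
  change Module.finrank k (MvPowerSeries (Fin d) k ⧸ (Ideal.span {δ} ⊔ varPow k d q)) + _ ≤ _ at hle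
  omega

end Box

end MvPowerSeries

/-! ### Isotropic subspaces for forms with a small radical. -/

section LinearAlgebra

variable {k E : Type*} [Field k] [AddCommGroup E] [Module k E]

theorem finrank_quotient_le_of_le_sup {V Y Z : Submodule k E} (h : Z ≤ Y ⊔ V)
    [FiniteDimensional k (E ⧸ V)] [FiniteDimensional k (E ⧸ Z)] [FiniteDimensional k Y] :
    Module.finrank k (E ⧸ V) ≤ Module.finrank k (E ⧸ Z) + Module.finrank k Y := by
  let π : (E ⧸ V) →ₗ[k] (E ⧸ (Y ⊔ V)) := Submodule.factor le_sup_right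
  have hπ : Function.Surjective π := Submodule.factor_surjective le_sup_right
  have h1 := LinearMap.finrank_range_add_finrank_ker π
  rw [LinearMap.range_eq_top.mpr hπ, finrank_top] at h1
  have h2 : Module.finrank k (E ⧸ (Y ⊔ V)) ≤ Module.finrank k (E ⧸ Z) :=
    LinearMap.finrank_le_finrank_of_surjective (f := Submodule.factor h)
      (Submodule.factor_surjective h)
  have h3 : LinearMap.ker π ≤ Y.map V.mkQ := by
    intro x hx
    obtain ⟨x, rfl⟩ := V.mkQ_surjective x
    have hx' : x ∈ Y ⊔ V := by simpa [π] using hx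
    obtain ⟨y, hy, v, hv, rfl⟩ := Submodule.mem_sup.mp hx'
    exact ⟨y, hy, by simpa using hv⟩
  have h4 := Submodule.finrank_mono h3
  have h5 := Submodule.finrank_map_le V.mkQ Y
  omega

/-- Isotropy puts `L(V)` inside the annihilator of `V`, of dimension `dim E/V`, while the part of
`V` killed by `L` lies in `ker D`, of the same dimension as the cokernel of `D`. Together they bound
`dim V`. -/
theorem finrank_le_of_isotropic [FiniteDimensional k E] (V : Submodule k E)
    (L : E →ₗ[k] Module.Dual k E) (hL : ∀ v ∈ V, ∀ w ∈ V, L v w = 0) (D : E →ₗ[k] E)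
    (hD : LinearMap.ker L ≤ LinearMap.ker D) :
    Module.finrank k E ≤
      2 * Module.finrank k (E ⧸ V) + Module.finrank k (E ⧸ LinearMap.range D) := by
  have h1 := LinearMap.finrank_range_add_finrank_ker (L.domRestrict V)
  have h2 : Module.finrank k (LinearMap.range (L.domRestrict V)) ≤ Module.finrank k (E ⧸ V) := by
    rw [← Subspace.dual_finrank_eq (V := E ⧸ V), V.dualQuotEquivDualAnnihilator.finrank_eq]
    refine Submodule.finrank_mono ?_
    rintro _ ⟨v, rfl⟩
    rw [Submodule.mem_dualAnnihilator]
    exact fun w hw => hL v v.2 w hw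
  have h3 : Module.finrank k (LinearMap.ker (L.domRestrict V)) ≤
      Module.finrank k (LinearMap.ker D) := by
    refine LinearMap.finrank_le_finrank_of_injective
      (f := (V.subtype.restrict (p := LinearMap.ker (L.domRestrict V)) (q := LinearMap.ker D)
        fun x hx => hD hx)) ?_
    intro x y hxy
    have := congrArg Subtype.val hxy
    exact Subtype.ext (Subtype.ext this)
  have h4 := LinearMap.finrank_range_add_finrank_ker D
  have h5 := Submodule.finrank_quotient_add_finrank (LinearMap.range D)
  have h6 := Submodule.finrank_quotient_add_finrank V
  omega

/-- `finrank_le_of_isotropic` for a form that descends to a finite-dimensional quotient. -/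
theorem finrank_quotient_le_of_isotropic (X V Z : Submodule k E) [FiniteDimensional k (E ⧸ X)]
    (hXV : X ≤ V) (L : E →ₗ[k] Module.Dual k E) (hLX : ∀ x ∈ X, L x = 0)
    (hXL : ∀ r, ∀ x ∈ X, L r x = 0)
    (hL : ∀ v ∈ V, ∀ w ∈ V, L v w = 0) (D : E →ₗ[k] E) (hDX : X ≤ X.comap D)
    (hD : ∀ r, L r = 0 → D r ∈ X) (hZ : Z ≤ LinearMap.range D ⊔ X) [FiniteDimensional k (E ⧸ Z)] :
    Module.finrank k (E ⧸ X) ≤ 2 * Module.finrank k (E ⧸ V) + Module.finrank k (E ⧸ Z) := by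
  let L₁ : E →ₗ[k] Module.Dual k (E ⧸ X) :=
    (X.dualQuotEquivDualAnnihilator.symm : _ →ₗ[k] _) ∘ₗ
      LinearMap.codRestrict X.dualAnnihilator L fun r => by
        rw [Submodule.mem_dualAnnihilator]
        exact hXL r
  have hL₁ : ∀ r t, L₁ r (X.mkQ t) = L r t := fun r t => by
    simp [L₁]
    rfl
  let L₂ : (E ⧸ X) →ₗ[k] Module.Dual k (E ⧸ X) := X.liftQ L₁ fun x hx => by
    rw [LinearMap.mem_ker]
    ext t
    change L₁ x (X.mkQ t) = 0
    rw [hL₁, hLX x hx]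
    rfl
  let D₂ : (E ⧸ X) →ₗ[k] (E ⧸ X) := X.mapQ X D hDX
  have key := finrank_le_of_isotropic (V.map X.mkQ) L₂ (by
    rintro _ ⟨v, hv, rfl⟩ _ ⟨w, hw, rfl⟩
    change L₁ v (X.mkQ w) = 0
    rw [hL₁]
    exact hL v hv w hw) D₂ (by
    intro r hr
    obtain ⟨r, rfl⟩ := X.mkQ_surjective r
    have h0 : L r = 0 := by
      ext t
      have : L₁ r (X.mkQ t) = 0 := by
        change L₂ (X.mkQ r) (X.mkQ t) = 0
        rw [LinearMap.mem_ker.mp hr]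
        rfl
      rwa [hL₁] at this
    rw [LinearMap.mem_ker]
    change X.mkQ (D r) = 0
    simpa using hD r h0)
  have e1 : Module.finrank k ((E ⧸ X) ⧸ V.map X.mkQ) = Module.finrank k (E ⧸ V) :=
    (Submodule.quotientQuotientEquivQuotient X V hXV).finrank_eq
  have e2 : Module.finrank k ((E ⧸ X) ⧸ LinearMap.range D₂) ≤ Module.finrank k (E ⧸ Z) := by
    have hZ' : Z ≤ LinearMap.ker ((LinearMap.range D₂).mkQ ∘ₗ X.mkQ) := by
      refine hZ.trans (sup_le ?_ ?_)
      · rintro _ ⟨r, rfl⟩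
        rw [LinearMap.mem_ker, LinearMap.comp_apply, Submodule.mkQ_apply,
          Submodule.Quotient.mk_eq_zero]
        exact ⟨X.mkQ r, rfl⟩
      · intro x hx
        rw [LinearMap.mem_ker, LinearMap.comp_apply, show X.mkQ x = 0 by simpa using hx, map_zero]
    refine LinearMap.finrank_le_finrank_of_surjective (f := Z.liftQ _ hZ') ?_
    rw [← LinearMap.range_eq_top, Submodule.range_liftQ, LinearMap.range_eq_top]
    exact (Submodule.mkQ_surjective _).comp X.mkQ_surjective
  omega

end LinearAlgebra

/-! ### Quotients of a free algebra by extended ideals. -/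

section Basis

variable {P R ι : Type*} [CommRing P] [CommRing R] [Algebra P R] [Fintype ι]

theorem Module.Basis.mem_map_algebraMap_iff (b : Module.Basis ι P R) (I : Ideal P) (r : R) :
    r ∈ I.map (algebraMap P R) ↔ ∀ i, b.repr r i ∈ I := by
  have h : r ∈ I.map (algebraMap P R) ↔ r ∈ I • (⊤ : Submodule P R) := by
    rw [Ideal.smul_top_eq_map]; rfl
  rw [h]
  clear h
  constructor
  · intro hr i
    induction hr using Submodule.smul_induction_on' with
    | smul a ha n _ => simpa using I.mul_mem_right _ ha
    | add x _ y _ hx hy => simpa using I.add_mem hx hy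
  · intro hr
    rw [← b.sum_repr r]
    exact Submodule.sum_mem _ fun i _ => Submodule.smul_mem_smul (hr i) trivial

variable {k : Type*} [Field k] [Algebra k P] [Algebra k R] [IsScalarTower k P R]

/-- The quotient of a free algebra by an extended ideal, in coordinates. -/
noncomputable def Module.Basis.quotientMapEquiv (b : Module.Basis ι P R) (I : Ideal P) :
    (R ⧸ I.map (algebraMap P R)) ≃ₗ[k] (ι → P ⧸ I) := by
  let f : R →ₗ[P] (ι → P ⧸ I) := LinearMap.pi fun i => (I.mkQ : P →ₗ[P] P ⧸ I) ∘ₗ b.coord i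
  have hf : Function.Surjective f := by
    intro g
    choose c hc using fun i => Submodule.mkQ_surjective I (g i)
    refine ⟨∑ j, c j • b j, ?_⟩
    ext i
    simp only [f, LinearMap.pi_apply, LinearMap.comp_apply, Module.Basis.coord_apply,
      Module.Basis.repr_sum_self]
    exact hc i
  have hker : ((I.map (algebraMap P R)).restrictScalars k) =
      LinearMap.ker (f.restrictScalars k) := by
    ext r
    simp [b.mem_map_algebraMap_iff, f, funext_iff, Ideal.Quotient.eq_zero_iff_mem]
  exact (Submodule.Quotient.restrictScalarsEquiv k (I.map (algebraMap P R))).symm ≪≫ₗ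
    Submodule.quotEquivOfEq _ _ hker ≪≫ₗ
    (f.restrictScalars k).quotKerEquivOfSurjective hf

theorem Module.Basis.finrank_quotient_map (b : Module.Basis ι P R) (I : Ideal P)
    [FiniteDimensional k (P ⧸ I)] :
    Module.finrank k (R ⧸ I.map (algebraMap P R)) =
      Fintype.card ι * Module.finrank k (P ⧸ I) := by
  rw [(b.quotientMapEquiv (k := k) I).finrank_eq, Module.finrank_pi_fintype]
  simp

theorem Module.Basis.finiteDimensional_quotient_map (b : Module.Basis ι P R) (I : Ideal P)
    [FiniteDimensional k (P ⧸ I)] :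
    FiniteDimensional k (R ⧸ I.map (algebraMap P R)) :=
  Module.Finite.equiv (b.quotientMapEquiv (k := k) I).symm

end Basis

/-! ### Clearing denominators: from the generic fibre to the free algebra. -/

section Descent

open TensorProduct

variable (p : ℕ) [Fact p.Prime] {P R ι : Type*} [CommRing P] [IsDomain P] [CharP P p]
  [CommRing R] [Algebra P R] [Fintype ι] (b : Module.Basis ι P R)

/-- Both structures exist on `Frac P ⊗ R`; multiplying by a common denominator of their matrices
makes them integral. The elements `δ` measure what is lost: the image of `ψ` spans, and the form is
perfect, after inverting them. -/
theorem exists_integral_frobenius_and_form [Nonempty ι] :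
    ∃ s : ℕ, (∃ ψ : R →+ R, (∀ (c : P) (r : R), ψ (c • r) = c ^ p • ψ r) ∧
        (∀ a r : R, ψ (a ^ p ^ s * r) = a ^ p ^ (s + 1) * ψ r) ∧
        ∃ δ : P, δ ≠ 0 ∧ ∀ r : R, δ • r ∈ Submodule.span P (Set.range ψ)) ∧
      ∃ β : R →ₗ[P] R →ₗ[P] P, (∀ a r t : R, β (a ^ p ^ s * r) t = β r (a ^ p ^ s * t)) ∧
        ∃ δ : P, δ ≠ 0 ∧ ∀ i, ∃ t, ∀ r, β r t = δ * b.repr r i := by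
  classical
  let K := FractionRing P
  let A := K ⊗[P] R
  let b' : Module.Basis ι K A := b.baseChange K
  let inc : R →ₐ[P] A := Algebra.TensorProduct.includeRight
  have hb' : ∀ i, b' i = inc (b i) := fun i => Module.Basis.baseChange_apply ..
  have hrepr : ∀ r i, b'.repr (inc r) i = algebraMap P K (b.repr r i) := fun r i => by
    have : inc r = 1 ⊗ₜ r := rfl
    rw [this, Module.Basis.baseChange_repr_tmul, Algebra.smul_def, mul_one]
  have hinj : Function.Injective inc := by
    intro r t h
    apply b.repr.injective
    ext i
    apply IsFractionRing.injective P K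
    rw [← hrepr, ← hrepr, h]
  have hinc_smul : ∀ (c : P) (r : R), inc (c • r) = algebraMap P K c • inc r := fun c r => by
    rw [map_smul, algebraMap_smul]
  have hCK : CharP K p := charP_of_injective_algebraMap (IsFractionRing.injective P K) p
  have : Nontrivial A := ⟨b' (Classical.arbitrary ι), 0, b'.ne_zero _⟩
  have hCA : CharP A p := charP_of_injective_algebraMap (algebraMap K A).injective p
  have : FiniteDimensional K A := Module.Finite.of_basis b'
  obtain ⟨s, ⟨ψ', hψ1, hψ2, hψ3⟩, β', hβ1, hβ2⟩ := exists_frobenius_and_form K p A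
  refine ⟨s, ?_, ?_⟩
  · obtain ⟨⟨δ₀, hδ₀⟩, hden⟩ := IsLocalization.exist_integer_multiples_of_finite
      (nonZeroDivisors P) (S := K) fun x : ι × ι => b'.repr (ψ' (b' x.1)) x.2
    choose m hm using hden
    have hδ₀' : algebraMap P K δ₀ ≠ 0 := by
      simpa using nonZeroDivisors.ne_zero hδ₀
    -- This is `δ₀ • ψ'` restricted to `R`, defined on the basis and extended semilinearly.
    let ψ : R →+ R :=
      { toFun := fun r => ∑ j, b.repr r j ^ p • ∑ i, m (j, i) • b i
        map_zero' := by simp [(Fact.out : p.Prime).ne_zero]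
        map_add' := fun r t => by
          rw [← Finset.sum_add_distrib]
          refine Finset.sum_congr rfl fun j _ => ?_
          rw [map_add, Finsupp.add_apply, add_pow_char, add_smul] }
    have hψb : ∀ j, inc (∑ i, m (j, i) • b i) = algebraMap P K δ₀ • ψ' (b' j) := fun j => by
      conv_rhs => rw [← b'.sum_repr (ψ' (b' j)), Finset.smul_sum]
      rw [map_sum]
      refine Finset.sum_congr rfl fun i _ => ?_
      rw [hinc_smul, hm, ← hb', smul_smul, Algebra.smul_def]
    have hψ : ∀ r, inc (ψ r) = algebraMap P K δ₀ • ψ' (inc r) := fun r => by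
      conv_rhs => rw [← b.sum_repr r]
      change inc (∑ j, b.repr r j ^ p • ∑ i, m (j, i) • b i) = _
      rw [map_sum, map_sum, map_sum, Finset.smul_sum]
      refine Finset.sum_congr rfl fun j _ => ?_
      rw [hinc_smul, hψb, hinc_smul, hψ1, ← hb', map_pow, smul_comm]
    refine ⟨ψ, fun c r => hinj ?_, fun a r => hinj ?_, ?_⟩
    · rw [hψ, hinc_smul, hψ1, hinc_smul, hψ, map_pow, smul_comm]
    · rw [hψ, map_mul, map_pow, hψ2, map_mul, map_pow, hψ, mul_smul_comm]
    · have hspan : ⊤ ≤ Submodule.span K (Set.range fun j => inc (ψ (b j))) := by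
        rw [← hψ3, Submodule.span_le]
        rintro _ ⟨y, rfl⟩
        rw [SetLike.mem_coe, ← b'.sum_repr y, map_sum]
        refine Submodule.sum_mem _ fun j _ => ?_
        rw [hψ1]
        refine Submodule.smul_mem _ _ ?_
        have : ψ' (b' j) = (algebraMap P K δ₀)⁻¹ • inc (ψ (b j)) := by
          rw [hψ, ← hb', smul_smul, inv_mul_cancel₀ hδ₀', one_smul]
        rw [this]
        exact Submodule.smul_mem _ _ (Submodule.subset_span ⟨j, rfl⟩)
      have hc : ∀ i, ∃ c : ι → K, ∑ j, c j • inc (ψ (b j)) = inc (b i) := fun i =>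
        (Submodule.mem_span_range_iff_exists_fun K).mp (hspan trivial)
      choose c hc using hc
      -- The `ψ (b j)` span over `K`; `δ₁` is a common denominator for the coordinates of all `b i`
      -- in terms of them.
      obtain ⟨⟨δ₁, hδ₁⟩, hden⟩ := IsLocalization.exist_integer_multiples_of_finite
        (nonZeroDivisors P) (S := K) fun x : ι × ι => c x.1 x.2
      choose n hn using hden
      have hδb : ∀ i, δ₁ • b i = ∑ j, n (i, j) • ψ (b j) := fun i => hinj <| by
        rw [hinc_smul, ← hc, Finset.smul_sum, map_sum]
        refine Finset.sum_congr rfl fun j _ => ?_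
        rw [hinc_smul, hn, smul_smul, Algebra.smul_def]
      refine ⟨δ₁, nonZeroDivisors.ne_zero hδ₁, fun r => ?_⟩
      rw [← b.sum_repr r, Finset.smul_sum]
      refine Submodule.sum_mem _ fun i _ => ?_
      rw [smul_comm, hδb]
      exact Submodule.smul_mem _ _ (Submodule.sum_mem _ fun j _ =>
        Submodule.smul_mem _ _ (Submodule.subset_span ⟨_, rfl⟩))
  · obtain ⟨⟨δ₀, hδ₀⟩, hden⟩ := IsLocalization.exist_integer_multiples_of_finite
      (nonZeroDivisors P) (S := K) fun x : ι × ι => β' (b' x.1) (b' x.2)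
    choose g hg using hden
    have hδ₀' : algebraMap P K δ₀ ≠ 0 := by
      simpa using nonZeroDivisors.ne_zero hδ₀
    let G : Matrix ι ι P := Matrix.of fun i j => g (i, j)
    let β : R →ₗ[P] R →ₗ[P] P := Matrix.toLinearMap₂ b b G
    have hβ : ∀ r t, algebraMap P K (β r t) = algebraMap P K δ₀ * β' (inc r) (inc t) := by
      intro r t
      have h1 : β r t = ∑ i, ∑ j, b.repr r i * b.repr t j * g (i, j) := by
        rw [Matrix.toLinearMap₂_apply]
        refine Finset.sum_congr rfl fun i _ => Finset.sum_congr rfl fun j _ => ?_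
        simp [G, mul_assoc]
      have h2 : β' (inc r) (inc t) = ∑ i, ∑ j, algebraMap P K (b.repr r i) *
          algebraMap P K (b.repr t j) * β' (b' i) (b' j) := by
        conv_lhs => rw [← b'.sum_repr (inc r), ← b'.sum_repr (inc t)]
        simp only [hrepr, map_sum, LinearMap.sum_apply, map_smul, LinearMap.smul_apply,
          smul_eq_mul, Finset.mul_sum]
        rw [Finset.sum_comm]
        refine Finset.sum_congr rfl fun i _ => Finset.sum_congr rfl fun j _ => ?_
        ring
      rw [h1, h2, map_sum, Finset.mul_sum]
      refine Finset.sum_congr rfl fun i _ => ?_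
      rw [map_sum, Finset.mul_sum]
      refine Finset.sum_congr rfl fun j _ => ?_
      rw [map_mul, map_mul, hg, Algebra.smul_def]
      exact mul_left_comm _ _ _
    have hβb : ∀ i j, β (b i) (b j) = G i j := fun i j => by
      rw [← LinearMap.toMatrix₂_apply b b β i j, LinearMap.toMatrix₂_toLinearMap₂]
    refine ⟨β, fun a r t => IsFractionRing.injective P K ?_, G.det, ?_, fun i => ?_⟩
    · rw [hβ, hβ, map_mul inc, map_pow inc, hβ1, map_mul inc, map_pow inc]
    · intro hdet
      -- A vector in the left kernel of the Gram matrix would be a nonzero element of the radical of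
      -- `β'`.
      obtain ⟨v, hv, hvG⟩ := Matrix.exists_vecMul_eq_zero_iff.mpr hdet
      apply hv
      have h0 : inc (∑ i, v i • b i) = 0 := by
        refine hβ2 _ fun y => ?_
        rw [← b'.sum_repr y, map_sum]
        refine Finset.sum_eq_zero fun j _ => ?_
        rw [map_smul]
        have : β (∑ i, v i • b i) (b j) = 0 := by
          have := congrFun hvG j
          simp only [map_sum, map_smul, LinearMap.sum_apply, LinearMap.smul_apply, hβb,
            smul_eq_mul]
          simpa [Matrix.vecMul, dotProduct] using this
        have h3 := hβ (∑ i, v i • b i) (b j)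
        rw [this, map_zero, ← hb'] at h3
        rw [(mul_eq_zero.mp h3.symm).resolve_left hδ₀', smul_zero]
      have h1 : ∑ i, v i • b i = 0 := hinj (by rw [h0, map_zero])
      ext i
      have := congrArg (fun r => b.repr r i) h1
      simp only [Module.Basis.repr_sum_self] at this
      simpa using this
    -- By `G * adj G = det G`, pairing with a column of the adjugate reads off one coordinate times
    -- `det G`.
    · refine ⟨∑ j, G.adjugate j i • b j, fun r => ?_⟩
      conv_lhs => rw [← b.sum_repr r]
      simp only [map_sum, map_smul, LinearMap.sum_apply, LinearMap.smul_apply, hβb,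
        smul_eq_mul]
      have hadj : ∀ l, ∑ j, G.adjugate j i * G l j = if l = i then G.det else 0 := fun l => by
        have := congrFun (congrFun G.mul_adjugate l) i
        rw [Matrix.mul_apply] at this
        simp only [mul_comm (G.adjugate _ _), this, Matrix.smul_apply, Matrix.one_apply]
        simp
      calc _ = ∑ l, b.repr r l * ∑ j, G.adjugate j i * G l j := by
            simp only [Finset.mul_sum]
            rw [Finset.sum_comm]
            refine Finset.sum_congr rfl fun j _ => Finset.sum_congr rfl fun l _ => ?_
            exact mul_left_comm _ _ _
        _ = _ := by
            simp only [hadj, mul_ite, mul_zero, Finset.sum_ite_eq', Finset.mem_univ, if_true]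
            exact mul_comm _ _

end Descent

/-! ### The two length estimates over the power series ring. -/

section HilbertKunz

open MvPowerSeries

variable {k : Type*} [Field k] {d : ℕ} {R : Type*} [CommRing R]
  [Algebra (MvPowerSeries (Fin d) k) R]

/-- The ideal generated by the `q`-th powers of the elements of `S`. -/
def powSpan (S : Set R) (q : ℕ) : Ideal R := Ideal.span ((fun a => a ^ q) '' S)

theorem map_varPow_le_powSpan {S : Set R}
    (hS : ∀ i, algebraMap (MvPowerSeries (Fin d) k) R (X i) ∈ S) (q : ℕ) :
    (varPow k d q).map (algebraMap (MvPowerSeries (Fin d) k) R) ≤ powSpan S q := by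
  rw [varPow, Ideal.map_span, Ideal.span_le]
  rintro _ ⟨_, ⟨i, rfl⟩, rfl⟩
  exact Ideal.subset_span ⟨_, hS i, (map_pow _ _ _).symm⟩

variable [Algebra k R] [IsScalarTower k (MvPowerSeries (Fin d) k) R] {ι : Type*} [Fintype ι]

theorem finiteDimensional_quotient_powSpan (b : Module.Basis ι (MvPowerSeries (Fin d) k) R)
    {S : Set R} (hS : ∀ i, algebraMap (MvPowerSeries (Fin d) k) R (X i) ∈ S) (q : ℕ) :
    FiniteDimensional k (R ⧸ powSpan S q) := by
  have := b.finiteDimensional_quotient_map (k := k) (varPow k d q)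
  exact Module.Finite.of_surjective
    (Ideal.Quotient.factorₐ k (map_varPow_le_powSpan hS q)).toLinearMap
    (Ideal.Quotient.factor_surjective (map_varPow_le_powSpan hS q))

theorem MvPowerSeries.finiteDimensional_quotient_sup_varPow (δ : MvPowerSeries (Fin d) k) (q : ℕ) :
    FiniteDimensional k (MvPowerSeries (Fin d) k ⧸ (Ideal.span {δ} ⊔ varPow k d q)) :=
  Module.Finite.of_surjective
    (Ideal.Quotient.factorₐ k (le_sup_right (a := Ideal.span {δ}) (b := varPow k d q))).toLinearMap
    (Ideal.Quotient.factor_surjective le_sup_right)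

theorem MvPowerSeries.sub_sum_monomial_mem_varPow (c : MvPowerSeries (Fin d) k) (q : ℕ)
    [Fintype (box fun _ : Fin d => q)] :
    c - ∑ γ : box fun _ : Fin d => q, monomial γ.1 (coeff γ.1 c) ∈ varPow k d q := by
  classical
  rw [mem_varPow_iff]
  intro α hα
  rw [map_sub, map_sum, Finset.sum_eq_single (⟨α, hα⟩ : box fun _ : Fin d => q)]
  · simp
  · intro γ _ hγ
    rw [coeff_monomial, if_neg]
    rintro rfl
    exact hγ rfl
  · simp

/-- Since `ψ` maps `powSpan S q` into `powSpan S (p * q)`, lifts `r i` of a basis of `R ⧸ powSpan S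
q` give elements `X^γ ψ(r i)`, with all entries of `γ` below `p`, that span the `P`-span of `ψ`
modulo `powSpan S (p * q)`. They number `p ^ d` times the dimension, and what they miss is killed by
`δ`. -/
theorem finrank_quotient_powSpan_mul_le (p : ℕ) [Fact p.Prime]
    (b : Module.Basis ι (MvPowerSeries (Fin d) k) R)
    {S : Set R} (hS : ∀ i, algebraMap (MvPowerSeries (Fin d) k) R (X i) ∈ S)
    (s : ℕ) (ψ : R →+ R)
    (hψ1 : ∀ (c : MvPowerSeries (Fin d) k) (r : R), ψ (c • r) = c ^ p • ψ r)
    (hψ2 : ∀ a r : R, ψ (a ^ p ^ s * r) = a ^ p ^ (s + 1) * ψ r)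
    (δ : MvPowerSeries (Fin d) k)
    (hδ : ∀ r : R, δ • r ∈ Submodule.span (MvPowerSeries (Fin d) k) (Set.range ψ)) (Q : ℕ) :
    Module.finrank k (R ⧸ powSpan S (p ^ (s + 1) * Q)) ≤
      p ^ d * Module.finrank k (R ⧸ powSpan S (p ^ s * Q)) + Fintype.card ι *
        Module.finrank k (MvPowerSeries (Fin d) k ⧸
          (Ideal.span {δ} ⊔ varPow k d (p ^ (s + 1) * Q))) := by
  classical
  have hp : 0 < p := (Fact.out : p.Prime).pos
  set q := p ^ s * Q with hq
  have hpq : p ^ (s + 1) * Q = p * q := by rw [hq, pow_succ]; ring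
  -- Here `q` is a multiple of `p ^ s`, so `a ^ q` is a `p ^ s`-th power and leaves `ψ` as `a ^ (p *
  -- q)`. The extra factor `t` is what lets the induction pass through multiples.
  have hVV : ∀ v ∈ powSpan S q, ψ v ∈ powSpan S (p * q) := by
    intro v hv
    suffices h : ∀ t, ψ (t * v) ∈ powSpan S (p * q) by simpa using h 1
    induction hv using Submodule.span_induction with
    | mem x hx =>
      obtain ⟨a, ha, rfl⟩ := hx
      intro t
      have : ψ (t * a ^ q) = a ^ (p * q) * ψ t := by
        rw [mul_comm t, hq, mul_comm (p ^ s) Q, pow_mul, hψ2, ← pow_mul]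
        congr 2
        rw [pow_succ]; ring
      simp only [this]
      exact Ideal.mul_mem_right _ _ (Ideal.subset_span ⟨a, ha, rfl⟩)
    | zero => simp
    | add x y _ _ hx hy =>
      intro t
      rw [mul_add, map_add]
      exact add_mem (hx t) (hy t)
    | smul c x _ hx =>
      intro t
      rw [smul_eq_mul, ← mul_assoc t]
      exact hx _
  rw [hpq]
  have hfd1 := finiteDimensional_quotient_powSpan (k := k) b hS q
  have hfd2 := finiteDimensional_quotient_powSpan (k := k) b hS (p * q)
  have hfd3 := finiteDimensional_quotient_sup_varPow δ (p * q)
  have hfd4 := b.finiteDimensional_quotient_map (k := k) (Ideal.span {δ} ⊔ varPow k d (p * q))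
  let e := Module.finBasis k (R ⧸ powSpan S q)
  choose r hr using fun i => Ideal.Quotient.mk_surjective (e i)
  let y : (box fun _ : Fin d => p) × Fin (Module.finrank k (R ⧸ powSpan S q)) → R :=
    fun x => (monomial x.1.1 (1 : k)) • ψ (r x.2)
  let Y : Submodule k R := Submodule.span k (Set.range y)
  have := Fintype.ofFinite (box fun _ : Fin d => p)
  have := Fintype.ofFinite (box fun _ : Fin d => p * q)
  have hY : Module.finrank k Y ≤ p ^ d * Module.finrank k (R ⧸ powSpan S q) := by
    refine (finrank_range_le_card y).trans ?_
    rw [Fintype.card_prod, Fintype.card_fin, ← Nat.card_eq_fintype_card, card_box]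
    simp
  have hYfd : FiniteDimensional k Y := FiniteDimensional.span_of_finite k (Set.finite_range y)
  have hsmul : ∀ (c : k) (x : R), c • x = (C c : MvPowerSeries (Fin d) k) • x := fun c x => by
    rw [show (C c : MvPowerSeries (Fin d) k) = algebraMap k _ c from rfl, algebraMap_smul]
  let D : Submodule k R := Y ⊔ (powSpan S (p * q)).restrictScalars k
  have hVD : ∀ x ∈ powSpan S (p * q), x ∈ D := fun x hx => Submodule.mem_sup_right hx
  have hXV : ∀ (c : MvPowerSeries (Fin d) k), c ∈ varPow k d (p * q) → ∀ x : R,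
      c • x ∈ powSpan S (p * q) := fun c hc x => by
    rw [Algebra.smul_def]
    exact Ideal.mul_mem_right _ _ (map_varPow_le_powSpan hS _ (Ideal.mem_map_of_mem _ hc))
  have hstep1 : ∀ (α : box fun _ : Fin d => p) (x : R),
      (monomial α.1 (1 : k)) • ψ x ∈ D := by
    intro α x
    have hx : x - ∑ i, e.repr (Ideal.Quotient.mk _ x) i • r i ∈ powSpan S q := by
      rw [← Ideal.Quotient.eq_zero_iff_mem, map_sub, map_sum]
      conv_lhs => rw [← e.sum_repr (Ideal.Quotient.mk _ x)]
      rw [sub_eq_zero]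
      refine Finset.sum_congr rfl fun i _ => ?_
      rw [← hr i]
      simp
      rfl
    have hx' := hVV _ hx
    rw [map_sub, map_sum] at hx'
    have hx'' : (monomial α.1 (1 : k)) • (ψ x - ∑ i, ψ (e.repr (Ideal.Quotient.mk _ x) i • r i)) ∈
        powSpan S (p * q) := by
      rw [Algebra.smul_def]
      exact Ideal.mul_mem_left _ _ hx'
    rw [smul_sub] at hx''
    rw [← sub_add_cancel ((monomial α.1 (1 : k)) • ψ x)
      ((monomial α.1 (1 : k)) • ∑ i, ψ (e.repr (Ideal.Quotient.mk _ x) i • r i))]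
    refine add_mem (hVD _ hx'') (Submodule.mem_sup_left ?_)
    rw [Finset.smul_sum]
    refine Submodule.sum_mem _ fun i _ => ?_
    rw [hsmul, hψ1, ← map_pow, smul_comm, ← hsmul]
    exact Submodule.smul_mem _ _ (Submodule.subset_span ⟨(α, i), rfl⟩)
  -- Divide the exponents by `p` with remainder: the quotient part moves inside `ψ` by
  -- semilinearity.
  have hstep2 : ∀ (γ : Fin d →₀ ℕ) (x : R), (monomial γ (1 : k)) • ψ x ∈ D := by
    intro γ x
    let m : Fin d →₀ ℕ := Finsupp.equivFunOnFinite.symm fun i => γ i / p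
    let α : Fin d →₀ ℕ := Finsupp.equivFunOnFinite.symm fun i => γ i % p
    have hγ : γ = α + p • m := by
      ext i
      simp [α, m, Nat.mod_add_div]
    have : (monomial γ (1 : k)) • ψ x =
        (monomial α (1 : k)) • ψ ((monomial m (1 : k)) • x) := by
      rw [hψ1, smul_smul, monomial_pow, monomial_mul_monomial, one_pow, mul_one, ← hγ]
    rw [this]
    exact hstep1 ⟨α, fun i => by simpa [α] using Nat.mod_lt _ hp⟩ _
  -- Modulo `varPow` a series is a finite sum of monomials, so `k`-linear combinations suffice.
  have hstep3 : ∀ (c : MvPowerSeries (Fin d) k) (x : R), c • ψ x ∈ D := by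
    intro c x
    rw [← sub_add_cancel c (∑ γ : box fun _ : Fin d => p * q, monomial γ.1 (coeff γ.1 c)),
      add_smul]
    refine add_mem (hVD _ (hXV _ (sub_sum_monomial_mem_varPow c _) _)) ?_
    rw [Finset.sum_smul]
    refine Submodule.sum_mem _ fun γ _ => ?_
    have : monomial γ.1 (coeff γ.1 c) = C (coeff γ.1 c) * monomial γ.1 (1 : k) := by
      rw [← monomial_zero_eq_C_apply, monomial_mul_monomial, zero_add, mul_one]
    rw [this, mul_smul, ← hsmul]
    exact Submodule.smul_mem _ _ (hstep2 _ _)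
  have hW : ∀ x ∈ Submodule.span (MvPowerSeries (Fin d) k) (Set.range ψ), x ∈ D := by
    intro x hx
    obtain ⟨c, rfl⟩ := Finsupp.mem_span_range_iff_exists_finsupp.mp hx
    exact Submodule.sum_mem _ fun i _ => hstep3 _ _
  have hZ : (((Ideal.span {δ} ⊔ varPow k d (p * q)).map
      (algebraMap (MvPowerSeries (Fin d) k) R)).restrictScalars k) ≤ D := by
    intro x hx
    rw [Submodule.restrictScalars_mem, Ideal.map_sup, Ideal.map_span, Set.image_singleton,
      Submodule.mem_sup] at hx
    obtain ⟨u, hu, v, hv, rfl⟩ := hx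
    obtain ⟨t, rfl⟩ := Ideal.mem_span_singleton'.mp hu
    refine add_mem (hW _ ?_) (hVD _ (map_varPow_le_powSpan hS _ hv))
    rw [mul_comm, ← Algebra.smul_def]
    exact hδ t
  have : FiniteDimensional k (R ⧸ (powSpan S (p * q)).restrictScalars k) := hfd2
  have : FiniteDimensional k (R ⧸ (((Ideal.span {δ} ⊔ varPow k d (p * q)).map
      (algebraMap (MvPowerSeries (Fin d) k) R)).restrictScalars k)) := hfd4
  have hfinal := finrank_quotient_le_of_le_sup hZ
  have hmap := b.finrank_quotient_map (k := k) (Ideal.span {δ} ⊔ varPow k d (p * q))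
  change Module.finrank k (R ⧸ powSpan S (p * q)) ≤ Module.finrank k (R ⧸
    (Ideal.span {δ} ⊔ varPow k d (p * q)).map (algebraMap (MvPowerSeries (Fin d) k) R)) + _ at hfinal
  rw [hmap] at hfinal
  omega

/-- Modulo `varPow` the form `β` makes `powSpan S q` isotropic: a factor `a ^ q` can be moved across
to meet `c ^ q`, and the product vanishes there. Composing with a generator of the dual of `P ⧸
varPow` gives a `k`-valued form whose radical is killed by `δ`, and the isotropic bound applies. -/
theorem card_mul_pow_le_finrank_quotient_powSpan (p : ℕ)
    (b : Module.Basis ι (MvPowerSeries (Fin d) k) R)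
    {S : Set R} (hS : ∀ i, algebraMap (MvPowerSeries (Fin d) k) R (X i) ∈ S)
    (s : ℕ) (β : R →ₗ[MvPowerSeries (Fin d) k] R →ₗ[MvPowerSeries (Fin d) k] MvPowerSeries (Fin d) k)
    (hβ : ∀ a r t : R, β (a ^ p ^ s * r) t = β r (a ^ p ^ s * t))
    (δ : MvPowerSeries (Fin d) k) (hδ : ∀ i, ∃ t, ∀ r, β r t = δ * b.repr r i) (Q : ℕ)
    (hq : 0 < p ^ s * Q)
    (hSS : ∀ a ∈ S, ∀ c ∈ S, a ^ (p ^ s * Q) * c ^ (p ^ s * Q) ∈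
      (varPow k d (p ^ s * Q)).map (algebraMap (MvPowerSeries (Fin d) k) R)) :
    Fintype.card ι * (p ^ s * Q) ^ d ≤ 2 * Module.finrank k (R ⧸ powSpan S (p ^ s * Q)) +
      Fintype.card ι * Module.finrank k (MvPowerSeries (Fin d) k ⧸
          (Ideal.span {δ} ⊔ varPow k d (p ^ s * Q))) := by
  classical
  set q := p ^ s * Q
  let X' := (varPow k d q).map (algebraMap (MvPowerSeries (Fin d) k) R)
  have hβq : ∀ a r t : R, β (a ^ q * r) t = β r (a ^ q * t) := fun a r t => by
    simp only [q, mul_comm (p ^ s) Q, pow_mul]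
    exact hβ _ _ _
  have hright : ∀ r, ∀ x ∈ X', β r x ∈ varPow k d q := fun r x hx => by
    rw [← b.sum_repr x, map_sum]
    refine Ideal.sum_mem _ fun i _ => ?_
    rw [map_smul]
    exact Ideal.mul_mem_right _ _ ((b.mem_map_algebraMap_iff _ _).mp hx i)
  have hleft : ∀ r, ∀ x ∈ X', β x r ∈ varPow k d q := fun r x hx => by
    rw [← b.sum_repr x, map_sum, LinearMap.sum_apply]
    refine Ideal.sum_mem _ fun i _ => ?_
    rw [map_smul]
    exact Ideal.mul_mem_right _ _ ((b.mem_map_algebraMap_iff _ _).mp hx i)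
  have hiso₁ : ∀ c ∈ S, ∀ v ∈ powSpan S q, ∀ u t, β (u * v) (c ^ q * t) ∈ varPow k d q := by
    intro c hc v hv
    induction hv using Submodule.span_induction with
    | mem x hx =>
      obtain ⟨a, ha, rfl⟩ := hx
      intro u t
      simp only [mul_comm u]
      rw [hβq, ← mul_assoc]
      exact hright _ _ (Ideal.mul_mem_right _ _ (hSS a ha c hc))
    | zero => simp
    | add x y _ _ hx hy =>
      intro u t
      rw [mul_add, map_add]
      exact add_mem (hx u t) (hy u t)
    | smul z x _ hx =>
      intro u t
      rw [smul_eq_mul, ← mul_assoc]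
      exact hx _ _
  have hiso : ∀ v ∈ powSpan S q, ∀ w ∈ powSpan S q, β v w ∈ varPow k d q := by
    intro v hv w hw
    suffices h : ∀ t, β v (w * t) ∈ varPow k d q by simpa using h 1
    induction hw using Submodule.span_induction with
    | mem x hx =>
      obtain ⟨c, hc, rfl⟩ := hx
      intro t
      simpa using hiso₁ c hc v hv 1 t
    | zero => simp
    | add x y _ _ hx hy =>
      intro t
      rw [add_mul, map_add]
      exact add_mem (hx t) (hy t)
    | smul z x _ hx =>
      intro t
      rw [smul_eq_mul, mul_comm z, mul_assoc]
      exact hx _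
  -- The exponent of the socle monomial of `P ⧸ varPow`. Taking its coefficient is the dualizing
  -- functional: a series outside `varPow` acquires a nonzero one after multiplication by a suitable
  -- monomial.
  let τ : Fin d →₀ ℕ := Finsupp.equivFunOnFinite.symm fun _ => q - 1
  have hτ : τ ∈ box fun _ : Fin d => q := fun i => by
    simp only [τ, Finsupp.equivFunOnFinite_symm_apply_apply]
    omega
  have hcoeff : ∀ f ∈ varPow k d q, coeff τ f = 0 := fun f hf => (mem_varPow_iff f).mp hf τ hτ
  let L : R →ₗ[k] Module.Dual k R := LinearMap.mk₂ k (fun r t => coeff τ (β r t))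
    (fun r r' t => by simp) (fun c r t => by
      rw [LinearMap.map_smul_of_tower, LinearMap.smul_apply, map_smul])
    (fun r t t' => by simp) (fun c r t => by
      rw [LinearMap.map_smul_of_tower, map_smul])
  have hL : ∀ r t, L r t = coeff τ (β r t) := fun r t => rfl
  have hnondeg : ∀ r, L r = 0 → ∀ t, β r t ∈ varPow k d q := by
    intro r hr t
    rw [mem_varPow_iff]
    intro α hα
    have hατ : α ≤ τ := fun i => by
      have : α i < q := hα i
      simp only [τ, Finsupp.equivFunOnFinite_symm_apply_apply]
      omega
    have h := LinearMap.congr_fun hr ((monomial (τ - α) (1 : k)) • t)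
    rw [hL, map_smul, smul_eq_mul, coeff_monomial_mul, if_pos tsub_le_self, one_mul,
      tsub_tsub_cancel_of_le hατ] at h
    exact h
  let D : R →ₗ[k] R := (LinearMap.lsmul (MvPowerSeries (Fin d) k) R δ).restrictScalars k
  have hDδ : ∀ r, D r = δ • r := fun r => rfl
  have hfd0 := b.finiteDimensional_quotient_map (k := k) (varPow k d q)
  have hfd3 := finiteDimensional_quotient_sup_varPow δ q
  have hfd4 := b.finiteDimensional_quotient_map (k := k) (Ideal.span {δ} ⊔ varPow k d q)
  have : FiniteDimensional k (R ⧸ X'.restrictScalars k) := hfd0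
  have : FiniteDimensional k (R ⧸ (((Ideal.span {δ} ⊔ varPow k d q).map
      (algebraMap (MvPowerSeries (Fin d) k) R)).restrictScalars k)) := hfd4
  have key := finrank_quotient_le_of_isotropic (X'.restrictScalars k)
    ((powSpan S q).restrictScalars k) (((Ideal.span {δ} ⊔ varPow k d q).map
      (algebraMap (MvPowerSeries (Fin d) k) R)).restrictScalars k)
    (map_varPow_le_powSpan hS q) L
    (fun x hx => by ext t; exact hcoeff _ (hleft t x hx))
    (fun r x hx => hcoeff _ (hright r x hx))
    (fun v hv w hw => hcoeff _ (hiso v hv w hw)) D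
    (fun x hx => by
      change δ • x ∈ X'
      rw [Algebra.smul_def]
      exact Ideal.mul_mem_left _ _ hx)
    (fun r hr => by
      change δ • r ∈ X'
      rw [b.mem_map_algebraMap_iff]
      intro i
      obtain ⟨t, ht⟩ := hδ i
      rw [map_smul, Finsupp.smul_apply, smul_eq_mul, ← ht]
      exact hnondeg r hr t)
    (by
      intro x hx
      rw [Submodule.restrictScalars_mem, Ideal.map_sup, Ideal.map_span, Set.image_singleton,
        Submodule.mem_sup] at hx
      obtain ⟨u, hu, v, hv, rfl⟩ := hx
      obtain ⟨t, rfl⟩ := Ideal.mem_span_singleton'.mp hu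
      refine Submodule.add_mem_sup ⟨t, ?_⟩ hv
      rw [hDδ, mul_comm, Algebra.smul_def])
  have h1 := b.finrank_quotient_map (k := k) (Ideal.span {δ} ⊔ varPow k d q)
  have h2 := b.finrank_quotient_map (k := k) (varPow k d q)
  rw [finrank_quotient_varPow] at h2
  change Module.finrank k (R ⧸ X') ≤ 2 * Module.finrank k (R ⧸ powSpan S q) +
    Module.finrank k (R ⧸ (Ideal.span {δ} ⊔ varPow k d q).map
      (algebraMap (MvPowerSeries (Fin d) k) R)) at key
  rwa [h1, h2] at key

end HilbertKunz

/-! ### Convergence of the normalised lengths. -/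

/-- Adding the tail `C * r ^ n / (1 - r)` of the geometric series makes the sequence eventually
decreasing, and it stays bounded below. -/
theorem exists_tendsto_of_le_add_geometric {a : ℕ → ℝ} (ha : ∀ n, 0 ≤ a n) {C r : ℝ}
    (hr0 : 0 ≤ r) (hr1 : r < 1) (s : ℕ) (h : ∀ n, s ≤ n → a (n + 1) ≤ a n + C * r ^ n) :
    ∃ L, Tendsto a atTop (𝓝 L) := by
  have hr : 1 - r ≠ 0 := by linarith
  set D := C / (1 - r) with hD
  have hCD : C = D * (1 - r) := by rw [hD, div_mul_cancel₀ _ hr]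
  let u : ℕ → ℝ := fun n => a (n + s) + D * r ^ (n + s)
  have hr' : Tendsto (fun n : ℕ => D * r ^ (n + s)) atTop (𝓝 0) := by
    have := (tendsto_pow_atTop_nhds_zero_of_lt_one hr0 hr1).comp (tendsto_add_atTop_nat s)
    simpa using this.const_mul D
  have hu : Antitone u := antitone_nat_of_succ_le fun n => by
    have := h (n + s) (Nat.le_add_left s n)
    simp only [u, Nat.add_right_comm n 1 s]
    rw [hCD] at this
    rw [pow_succ]
    nlinarith
  have hb : BddBelow (Set.range u) := by
    obtain ⟨m, hm⟩ := hr'.bddBelow_range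
    refine ⟨m, ?_⟩
    rintro _ ⟨n, rfl⟩
    have h1 : m ≤ D * r ^ (n + s) := hm ⟨n, rfl⟩
    have h2 := ha (n + s)
    simp only [u]
    linarith
  have hlim := tendsto_atTop_ciInf hu hb
  refine ⟨⨅ i, u i, ?_⟩
  rw [← tendsto_add_atTop_iff_nat s]
  have := hlim.sub hr'
  simpa [u] using this

section HilbertKunz

open MvPowerSeries

variable {k : Type*} [Field k] {d : ℕ} {R : Type*} [CommRing R]
  [Algebra (MvPowerSeries (Fin d) k) R]
  [Algebra k R] [IsScalarTower k (MvPowerSeries (Fin d) k) R] {ι : Type*} [Fintype ι]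

/-- After division by `q ^ d` the errors of order `q ^ (d - 1)` become multiples of `(1 / p) ^ t`:
summable in the comparison of successive terms, and vanishing in the lower bound. -/
theorem exists_tendsto_finrank_quotient_powSpan (p : ℕ) [Fact p.Prime] [CharP k p] (hd : 1 ≤ d)
    [Nonempty ι] (b : Module.Basis ι (MvPowerSeries (Fin d) k) R)
    {S : Set R} (hS : ∀ i, algebraMap (MvPowerSeries (Fin d) k) R (X i) ∈ S)
    (hSS : ∀ a ∈ S, ∀ c ∈ S, a * c ∈
      Ideal.span (Set.range fun i => algebraMap (MvPowerSeries (Fin d) k) R (X i))) :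
    ∃ L : ℝ, Tendsto (fun t : ℕ => (Module.finrank k (R ⧸ powSpan S (p ^ t)) : ℝ) /
        ((p ^ t : ℕ) : ℝ) ^ d) atTop (𝓝 L) ∧ (Fintype.card ι : ℝ) / 2 ≤ L := by
  have hp : p.Prime := Fact.out
  have hCP : CharP (MvPowerSeries (Fin d) k) p :=
    charP_of_injective_algebraMap (algebraMap k (MvPowerSeries (Fin d) k)).injective p
  have hinj : Function.Injective (algebraMap (MvPowerSeries (Fin d) k) R) := by
    have : Module.Free (MvPowerSeries (Fin d) k) R := Module.Free.of_basis b
    have : Nontrivial R := ⟨b (Classical.arbitrary ι), 0, b.ne_zero _⟩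
    exact FaithfulSMul.algebraMap_injective _ _
  have hCR : CharP R p := charP_of_injective_algebraMap hinj p
  have hpow : ∀ t : ℕ, ∀ a ∈ S, ∀ c ∈ S, a ^ (p ^ t) * c ^ (p ^ t) ∈
      (varPow k d (p ^ t)).map (algebraMap (MvPowerSeries (Fin d) k) R) := by
    intro t a ha c hc
    obtain ⟨f, hf⟩ := (Ideal.mem_span_range_iff_exists_fun).mp (hSS a ha c hc)
    rw [← mul_pow, ← hf, sum_pow_char_pow]
    refine Ideal.sum_mem _ fun i _ => ?_
    rw [mul_pow, ← map_pow]
    exact Ideal.mul_mem_left _ _ (Ideal.mem_map_of_mem _ (Ideal.subset_span ⟨i, rfl⟩))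
  have : IsDomain (MvPowerSeries (Fin d) k) := NoZeroDivisors.to_isDomain _
  obtain ⟨s, ⟨ψ, hψ1, hψ2, δ, hδ0, hδ⟩, β, hβ, ε, hε0, hε⟩ :=
    exists_integral_frobenius_and_form p b
  obtain ⟨C, hC⟩ := exists_finrank_quotient_sup_le δ hδ0
  obtain ⟨C', hC'⟩ := exists_finrank_quotient_sup_le ε hε0
  set e := Fintype.card ι
  let f : ℕ → ℕ := fun t => Module.finrank k (R ⧸ powSpan S (p ^ t))
  have hf1 : ∀ t, s ≤ t → f (t + 1) ≤ p ^ d * f t + e * (C * (p ^ (t + 1)) ^ (d - 1)) := by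
    intro t ht
    obtain ⟨m, rfl⟩ := Nat.exists_eq_add_of_le ht
    have h := finrank_quotient_powSpan_mul_le p b hS s ψ hψ1 hψ2 δ hδ (p ^ m)
    rw [← pow_add, ← pow_add, Nat.add_right_comm] at h
    refine h.trans (Nat.add_le_add_left (Nat.mul_le_mul_left _ ?_) _)
    exact hC _
  have hf2 : ∀ t, s ≤ t → e * (p ^ t) ^ d ≤ 2 * f t + e * (C' * (p ^ t) ^ (d - 1)) := by
    intro t ht
    obtain ⟨m, rfl⟩ := Nat.exists_eq_add_of_le ht
    have h := card_mul_pow_le_finrank_quotient_powSpan p b hS s β hβ ε hε (p ^ m)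
      (by rw [← pow_add]; exact pow_pos hp.pos _) (by rw [← pow_add]; exact hpow _)
    rw [← pow_add] at h
    refine h.trans (Nat.add_le_add_left (Nat.mul_le_mul_left _ ?_) _)
    exact hC' _
  have hp0 : (0 : ℝ) < p := by exact_mod_cast hp.pos
  have hp1 : (1 : ℝ) < p := by exact_mod_cast hp.one_lt
  have hq : ∀ t : ℕ, (0 : ℝ) < (p : ℝ) ^ t := fun t => pow_pos hp0 t
  have hdd : ∀ x : ℝ, x ^ d = x ^ (d - 1) * x := fun x => by
    rw [← pow_succ, Nat.sub_add_cancel hd]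
  let a : ℕ → ℝ := fun t => (f t : ℝ) / ((p ^ t : ℕ) : ℝ) ^ d
  have ha0 : ∀ t, 0 ≤ a t := fun t => by positivity
  have ha1 : ∀ t, s ≤ t → a (t + 1) ≤ a t + (e * C / p) * (1 / p : ℝ) ^ t := by
    intro t ht
    have h : (f (t + 1) : ℝ) ≤ p ^ d * f t + e * (C * (p ^ (t + 1)) ^ (d - 1)) := by
      exact_mod_cast hf1 t ht
    have h1 : a (t + 1) ≤ (p ^ d * f t + e * (C * (p ^ (t + 1)) ^ (d - 1))) /
        (((p : ℝ) ^ (t + 1)) ^ d) := by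
      simp only [a]
      push_cast
      gcongr
    refine h1.trans (le_of_eq ?_)
    simp only [a]
    push_cast
    have e1 : ((p : ℝ) ^ (t + 1)) ^ d = p ^ d * (p ^ t) ^ d := by rw [pow_succ, mul_pow]; ring
    have e2 : (e * (C * ((p : ℝ) ^ (t + 1)) ^ (d - 1))) / (((p : ℝ) ^ (t + 1)) ^ d) =
        (e * C / p) * (1 / p : ℝ) ^ t := by
      rw [hdd]
      have h2 := (pow_pos (hq (t + 1)) (d - 1)).ne'
      have h3 := (hq t).ne'
      rw [one_div, inv_pow, ← mul_assoc, mul_comm (((p : ℝ) ^ (t + 1)) ^ (d - 1)),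
        mul_div_mul_right _ _ h2, pow_succ]
      field_simp
    rw [add_div, e2, e1, mul_div_mul_left _ _ (pow_pos hp0 d).ne']
  have ha2 : ∀ t, s ≤ t → (e : ℝ) / 2 - (e * C' / 2) * (1 / p : ℝ) ^ t ≤ a t := by
    intro t ht
    have h : (e : ℝ) * (p ^ t) ^ d ≤ 2 * f t + e * (C' * (p ^ t) ^ (d - 1)) := by
      exact_mod_cast hf2 t ht
    simp only [a]
    push_cast
    rw [le_div_iff₀ (pow_pos (hq t) d), hdd]
    rw [hdd] at h
    have e3 : (1 / p : ℝ) ^ t * p ^ t = 1 := by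
      rw [← mul_pow, one_div, inv_mul_cancel₀ hp0.ne', one_pow]
    have e4 : (e * C' / 2) * (1 / p : ℝ) ^ t * (((p : ℝ) ^ t) ^ (d - 1) * p ^ t) =
        (e * C' / 2) * ((p : ℝ) ^ t) ^ (d - 1) := by
      calc _ = (e * C' / 2) * ((p : ℝ) ^ t) ^ (d - 1) * ((1 / p : ℝ) ^ t * p ^ t) := by ring
        _ = _ := by rw [e3, mul_one]
    rw [sub_mul, e4]
    linarith
  have hr0 : (0 : ℝ) ≤ 1 / p := by positivity
  have hr1 : (1 / p : ℝ) < 1 := by rw [div_lt_one hp0]; exact hp1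
  obtain ⟨L, hL⟩ := exists_tendsto_of_le_add_geometric ha0 hr0 hr1 s ha1
  refine ⟨L, hL, ?_⟩
  have hlow : Tendsto (fun t : ℕ => (e : ℝ) / 2 - (e * C' / 2) * (1 / p : ℝ) ^ t) atTop
      (𝓝 ((e : ℝ) / 2)) := by
    have := (tendsto_pow_atTop_nhds_zero_of_lt_one hr0 hr1).const_mul ((e : ℝ) * C' / 2)
    simpa using this.const_sub ((e : ℝ) / 2)
  exact le_of_tendsto_of_tendsto hlow hL (eventually_atTop.mpr ⟨s, ha2⟩)

end HilbertKunz

/-! ### Extensions of perfect fields are formally smooth. -/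

section FormallySmooth

open MvPolynomial

/-- This is injectivity of I/I² → Ω for the tautological presentation, spelled out. In this form the
condition concerns one polynomial, hence finitely many elements of `S`, at a time. -/
theorem subsingleton_h1Cotangent_iff_mem_ker_sq {R S : Type*} [CommRing R] [CommRing S]
    [Algebra R S] : Subsingleton (Algebra.H1Cotangent R S) ↔ ∀ f : MvPolynomial S R,
      aeval (id : S → S) f = 0 → (∀ a, aeval (id : S → S) (pderiv a f) = 0) →
      f ∈ RingHom.ker (aeval (R := R) (id : S → S)) ^ 2 := by
  let G := Algebra.Generators.self R S
  have hker : G.toExtension.ker = RingHom.ker (aeval (R := R) (id : S → S)) := rfl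
  have hval : G.val = id := rfl
  have hrepr : ∀ (x : G.toExtension.ker), G.toExtension.cotangentComplex (.mk x) = 0 ↔
      ∀ a, aeval (R := R) (id : S → S) (pderiv a x.1) = 0 := by
    intro x
    rw [← G.cotangentSpaceBasis.repr.map_eq_zero_iff, Finsupp.ext_iff]
    refine forall_congr' fun a => ?_
    rw [Algebra.Extension.cotangentComplex_mk]
    erw [G.cotangentSpaceBasis_repr_one_tmul]
    rfl
  rw [Algebra.Extension.subsingleton_h1Cotangent, injective_iff_map_eq_zero]
  constructor
  · intro h f hf hd
    have := h (.mk ⟨f, hf⟩) ((hrepr ⟨f, hf⟩).mpr hd)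
    rwa [Algebra.Extension.Cotangent.mk_eq_zero_iff] at this
  · intro h x hx
    obtain ⟨⟨f, hf⟩, rfl⟩ := Algebra.Extension.Cotangent.mk_surjective x
    rw [Algebra.Extension.Cotangent.mk_eq_zero_iff]
    exact h f hf ((hrepr ⟨f, hf⟩).mp hx)

/-- Every field extension of a perfect field is formally smooth. -/
theorem formallySmooth_of_perfectField (K L : Type*) [Field K] [PerfectField K]
    [Field L] [Algebra K L] : Algebra.FormallySmooth K L := by
  refine ⟨inferInstance, ?_⟩
  rw [subsingleton_h1Cotangent_iff_mem_ker_sq]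
  intro f hf hd
  classical
  let E : IntermediateField K L := IntermediateField.adjoin K (f.vars : Set L)
  have hE : (f.vars : Set L) ⊆ Set.range (algebraMap E L) := fun a ha =>
    ⟨⟨a, IntermediateField.subset_adjoin K _ ha⟩, rfl⟩
  obtain ⟨g, hg⟩ := exists_rename_eq_of_vars_subset_range f (algebraMap E L) (algebraMap E L).injective hE
  have hinj : Function.Injective (algebraMap E L) := (algebraMap E L).injective
  have haeval : ∀ h : MvPolynomial E K, aeval (id : L → L) (rename (algebraMap E L) h) =
      algebraMap E L (aeval (id : E → E) h) := fun h => by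
    rw [aeval_rename, ← MvPolynomial.aeval_algebraMap_apply]
    rfl
  -- The variables of `f` generate a finitely generated extension of the perfect field `K`, where
  -- formal smoothness is available.
  have : Algebra.EssFiniteType K E := IntermediateField.essFiniteType_iff.mpr (IntermediateField.fg_adjoin_finset f.vars)
  have hE2 := subsingleton_h1Cotangent_iff_mem_ker_sq.mp
    (Algebra.FormallySmooth.subsingleton_h1Cotangent (R := K) (A := E)) g
    (hinj (by rw [map_zero, ← haeval, hg, hf])) (fun a => hinj (by
      rw [map_zero, ← haeval, ← pderiv_rename hinj, hg, hd]))
  have hmap : (RingHom.ker (aeval (R := K) (id : E → E))).map (rename (R := K) (algebraMap E L)) ≤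
      RingHom.ker (aeval (R := K) (id : L → L)) := by
    rw [Ideal.map_le_iff_le_comap]
    intro h hh
    rw [Ideal.mem_comap, RingHom.mem_ker]
    rw [RingHom.mem_ker] at hh
    rw [haeval, hh, map_zero]
  rw [← hg]
  refine Ideal.pow_right_mono hmap 2 ?_
  rw [← Ideal.map_pow]
  exact Ideal.mem_map_of_mem _ hE2

end FormallySmooth

/-! ### Systems of parameters in Cohen–Macaulay rings are regular sequences. -/

section CohenMacaulay

open IsLocalRing RingTheory.Sequence
open scoped Pointwise

variable {A : Type u} [CommRing A] [IsLocalRing A] [IsNoetherianRing A]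

/-- If `y` is `M`-regular and `Q` annihilates a nonzero element of `M`, then `Q + (y)` annihilates
a nonzero element of `M / yM`. -/
theorem exists_ne_zero_quotSMulTop {M : Type*} [AddCommGroup M] [Module A M] [Module.Finite A M]
    {Q : Ideal A} {y : A} (hy : y ∈ maximalIdeal A) (hreg : IsSMulRegular M y)
    (hQ : ∃ z : M, z ≠ 0 ∧ ∀ a ∈ Q, a • z = 0) :
    ∃ z : QuotSMulTop y M, z ≠ 0 ∧ ∀ a ∈ Q ⊔ Ideal.span {y}, a • z = 0 := by
  let N : Submodule A M := Submodule.torsionBySet A M (Q : Set A)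
  have hN : ∀ z, z ∈ N ↔ ∀ a ∈ Q, a • z = 0 := fun z => by
    simp [N, Submodule.mem_torsionBySet_iff]
  have hN0 : N ≠ ⊥ := by
    obtain ⟨z, hz0, hz⟩ := hQ
    exact fun h => hz0 ((Submodule.eq_bot_iff _).mp h z ((hN z).mpr hz))
  -- If `N ⊆ yM`, then `N = yN` because `y` is regular, and Nakayama gives `N = 0`.
  have hex : ∃ z ∈ N, z ∉ y • (⊤ : Submodule A M) := by
    by_contra! hcon
    apply hN0
    refine Submodule.eq_bot_of_le_smul_of_le_jacobson_bot (Ideal.span {y}) N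
      (IsNoetherian.noetherian N) ?_ ?_
    · intro z hz
      obtain ⟨w, -, rfl⟩ := (Submodule.mem_smul_pointwise_iff_exists _ _ _).mp (hcon z hz)
      rw [Submodule.ideal_span_singleton_smul]
      refine Submodule.smul_mem_pointwise_smul _ _ _ ((hN w).mpr fun a ha => ?_)
      apply isSMulRegular_iff_right_eq_zero_of_smul.mp hreg
      rw [smul_comm]
      exact (hN _).mp hz a ha
    · rw [Ideal.span_singleton_le_iff_mem, jacobson_eq_maximalIdeal _ bot_ne_top]
      exact hy
  obtain ⟨z, hz, hzy⟩ := hex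
  refine ⟨Submodule.Quotient.mk z, by rwa [Ne, Submodule.Quotient.mk_eq_zero], fun a ha => ?_⟩
  obtain ⟨b, hb, c, hc, rfl⟩ := Submodule.mem_sup.mp ha
  obtain ⟨t, rfl⟩ := Ideal.mem_span_singleton'.mp hc
  rw [← Submodule.Quotient.mk_smul, add_smul, (hN z).mp hz b hb, zero_add,
    Submodule.Quotient.mk_eq_zero, mul_comm, mul_smul]
  exact Submodule.smul_mem_pointwise_smul _ _ _ trivial

/-- The depth of `M` is at most the dimension of `A / Q` for an associated prime `Q` of `M`. -/
theorem length_le_ringKrullDim_quotient (rs : List A) (hrs : ∀ r ∈ rs, r ∈ maximalIdeal A)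
    {M : Type*} [AddCommGroup M] [Module A M] [Module.Finite A M] (hreg : IsRegular M rs)
    (Q : Ideal A) [Q.IsPrime] (hQ : ∃ z : M, z ≠ 0 ∧ ∀ a ∈ Q, a • z = 0) :
    (rs.length : WithBot ℕ∞) ≤ ringKrullDim (A ⧸ Q) := by
  induction rs generalizing M Q with
  | nil =>
    simpa using ringKrullDim_nonneg_of_nontrivial
  | cons y rs ih =>
    rw [isRegular_cons_iff] at hreg
    obtain ⟨z, hz0, hz⟩ := exists_ne_zero_quotSMulTop (hrs y (by simp)) hreg.1 hQ
    -- An associated prime of `M / yM` containing `Q + (y)`. As `y ∉ Q`, the dimension of the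
    -- quotient drops, matching the loss of one element of the sequence.
    obtain ⟨Q', hQ', hle⟩ := exists_le_isAssociatedPrime_of_isNoetherianRing A z hz0
    have hQQ' : Q ⊔ Ideal.span {y} ≤ Q' := fun a ha => hle (by
      rw [Submodule.mem_colon_singleton]
      exact hz a ha)
    have hyQ : y ∉ Q := fun hyQ => by
      obtain ⟨w, hw0, hw⟩ := hQ
      exact hw0 (isSMulRegular_iff_right_eq_zero_of_smul.mp hreg.1 w (hw y hyQ))
    obtain ⟨hprime, w, hw⟩ := isAssociatedPrime_iff.mp hQ'
    have h1 := ih (fun r hr => hrs r (by simp [hr])) hreg.2 Q' ⟨w, by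
      rintro rfl
      apply hprime.ne_top
      rw [hw, Submodule.colon_singleton_zero], fun a ha => by
      rw [hw, Submodule.mem_colon_singleton] at ha
      simpa using ha⟩
    have h2 := ringKrullDim_quotient_succ_le_of_nonZeroDivisor
      (r := Ideal.Quotient.mk Q y) (mem_nonZeroDivisors_of_ne_zero (by
        rwa [Ne, Ideal.Quotient.eq_zero_iff_mem]))
    have h3 : ringKrullDim (A ⧸ Q') ≤
        ringKrullDim ((A ⧸ Q) ⧸ Ideal.span {Ideal.Quotient.mk Q y}) := by
      refine ringKrullDim_le_of_surjective (Ideal.Quotient.lift _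
        (Ideal.Quotient.factor (le_sup_left.trans hQQ')) ?_) ?_
      · intro a ha
        obtain ⟨t, rfl⟩ := Ideal.mem_span_singleton'.mp ha
        rw [map_mul, Ideal.Quotient.factor_mk, Ideal.Quotient.eq_zero_iff_mem.mpr, mul_zero]
        exact hQQ' (Ideal.mem_sup_right (Ideal.mem_span_singleton_self y))
      · exact Ideal.Quotient.lift_surjective_of_surjective _ _
          (Ideal.Quotient.factor_surjective _)
    rw [List.length_cons, Nat.cast_add, Nat.cast_one]
    exact (add_le_add_left (h1.trans h3) 1).trans h2

/-- The regular element `x` need not belong to the given sequence, so depth is read from the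
vanishing of Ext out of the residue field, which passes to `M / xM` by the long exact sequence. -/
theorem exists_isRegular_quotSMulTop {M : Type u} [AddCommGroup M] [Module A M]
    [Module.Finite A M] [Nontrivial M] {x : A} (hx : x ∈ maximalIdeal A) (hreg : IsSMulRegular M x)
    (n : ℕ) (h : ∃ rs : List A, rs.length = n + 1 ∧ (∀ r ∈ rs, r ∈ maximalIdeal A) ∧
      IsRegular M rs) :
    ∃ rs : List A, rs.length = n ∧ (∀ r ∈ rs, r ∈ maximalIdeal A) ∧
      IsRegular (QuotSMulTop x M) rs := by
  obtain ⟨rs, hlen, hmem, hrs⟩ := h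
  let N : ModuleCat.{u} A := ModuleCat.of A (A ⧸ maximalIdeal A)
  have hsupp : Module.support A N = PrimeSpectrum.zeroLocus (maximalIdeal A : Set A) := by
    rw [Module.support_eq_zeroLocus, Ideal.annihilator_quotient]
  have hlt : ∀ (L : Type u) [AddCommGroup L] [Module A L] [Module.Finite A L] [Nontrivial L],
      maximalIdeal A • (⊤ : Submodule A L) < ⊤ := fun L _ _ _ _ =>
    (Ne.symm (Submodule.top_ne_ideal_smul_of_le_jacobson_annihilator
      (maximalIdeal_le_jacobson _))).lt_top
  have hext := ModuleCat.subsingleton_ext_of_exists_isRegular (maximalIdeal A) N hsupp.subset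
    (ModuleCat.of A M) (hlt M) rs hmem hrs
  have : Nontrivial (QuotSMulTop x M) := nontrivial_quotSMulTop_of_mem_maximalIdeal _ hx
  refine ModuleCat.exists_isRegular_of_exists_subsingleton_ext (maximalIdeal A) n
    (ModuleCat.of A (QuotSMulTop x M)) (hlt _) N hsupp fun i hi => ?_
  have zero1 := AddCommGrpCat.isZero_of_iff_subsingleton.mpr (hext i (by omega))
  have zero2 := AddCommGrpCat.isZero_of_iff_subsingleton.mpr (hext (i + 1) (by omega))
  exact AddCommGrpCat.subsingleton_of_isZero <|
    CategoryTheory.ShortComplex.Exact.isZero_of_both_zeros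
      ((CategoryTheory.Abelian.Ext.covariant_sequence_exact₃' N
        (IsSMulRegular.smulShortComplex_shortExact (M := ModuleCat.of A M) hreg)) i (i + 1) rfl)
      (zero1.eq_zero_of_src _) (zero2.eq_zero_of_tgt _)

/-- Krull's height theorem in `A ⧸ Q`: its maximal ideal is minimal over the images of `xs`. -/
theorem ringKrullDim_quotient_le_length (Q : Ideal A) [Q.IsPrime] (xs : List A)
    (hxs : ∀ x ∈ xs, x ∈ maximalIdeal A)
    (h : ∀ P : Ideal A, P.IsPrime → Q ≤ P → (∀ x ∈ xs, x ∈ P) → P = maximalIdeal A) :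
    ringKrullDim (A ⧸ Q) ≤ xs.length := by
  have : IsLocalRing (A ⧸ Q) := .of_surjective' (Ideal.Quotient.mk Q) Ideal.Quotient.mk_surjective
  rw [← IsLocalRing.maximalIdeal_height_eq_ringKrullDim]
  let T : Set (A ⧸ Q) := Ideal.Quotient.mk Q '' {x | x ∈ xs}
  have hT : T.Finite := (List.finite_toSet xs).image _
  have hcard : T.ncard ≤ xs.length := by
    classical
    refine (Set.ncard_image_le (List.finite_toSet xs)).trans ?_
    have : {x | x ∈ xs} = (xs.toFinset : Set A) := by ext; simp
    rw [this, Set.ncard_coe_finset]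
    exact xs.toFinset_card_le
  have hcomap : (maximalIdeal (A ⧸ Q)).comap (Ideal.Quotient.mk Q) = maximalIdeal A :=
    eq_maximalIdeal (Ideal.comap_isMaximal_of_surjective _ Ideal.Quotient.mk_surjective)
  have hmin : maximalIdeal (A ⧸ Q) ∈ (Ideal.span T).minimalPrimes := by
    refine ⟨⟨inferInstance, ?_⟩, ?_⟩
    · rw [Ideal.span_le]
      rintro _ ⟨x, hx, rfl⟩
      rw [SetLike.mem_coe, ← Ideal.mem_comap, hcomap]
      exact hxs x hx
    · rintro P ⟨hP, hTP⟩ -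
      have := h (P.comap (Ideal.Quotient.mk Q)) inferInstance
        (fun a ha => by simp [Ideal.mem_comap, Ideal.Quotient.eq_zero_iff_mem.mpr ha])
        fun x hx => hTP (Ideal.subset_span ⟨x, hx, rfl⟩)
      rw [← Ideal.map_comap_of_surjective _ Ideal.Quotient.mk_surjective (maximalIdeal (A ⧸ Q)),
        hcomap, ← this, Ideal.map_comap_of_surjective _ Ideal.Quotient.mk_surjective]
  have hle := Ideal.height_le_spanRank_toENat_of_mem_minimalPrimes _ _ hmin
  have hfg : (Ideal.span T).FG := IsNoetherian.noetherian _
  rw [Submodule.fg_iff_spanRank_eq_spanFinrank.mpr hfg, map_natCast] at hle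
  have hsp : (Ideal.span T).spanFinrank ≤ xs.length :=
    (Submodule.spanFinrank_span_le_ncard_of_finite hT).trans hcard
  have hle' : (maximalIdeal (A ⧸ Q)).height ≤ (xs.length : ℕ∞) := hle.trans (by exact_mod_cast hsp)
  exact_mod_cast hle'

/-- If the first parameter were a zero divisor, it would lie in an associated prime `Q`. Then `A ⧸
Q` has dimension at least the depth, but the remaining parameters, one too few, cut it down to the
closed point. -/
theorem isWeaklyRegular_of_parameters (xs : List A) (hxs : ∀ x ∈ xs, x ∈ maximalIdeal A)
    {M : Type u} [AddCommGroup M] [Module A M] [Module.Finite A M]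
    (h : ∀ P : Ideal A, P.IsPrime → Module.annihilator A M ≤ P → (∀ x ∈ xs, x ∈ P) →
      P = maximalIdeal A)
    (hdepth : ∃ rs : List A, rs.length = xs.length ∧ (∀ r ∈ rs, r ∈ maximalIdeal A) ∧
      IsRegular M rs) : IsWeaklyRegular M xs := by
  induction xs generalizing M with
  | nil => exact IsWeaklyRegular.nil A M
  | cons x xs ih =>
    have : Nontrivial M := hdepth.choose_spec.2.2.nontrivial
    have hx : IsSMulRegular M x := by
      by_contra hx
      have hx' : x ∈ ⋃ p ∈ associatedPrimes A M, (p : Set A) := by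
        rw [biUnion_associatedPrimes_eq_compl_regular]
        exact hx
      simp only [Set.mem_iUnion] at hx'
      obtain ⟨Q, hQ, hxQ⟩ := hx'
      obtain ⟨hprime, w, hw⟩ := isAssociatedPrime_iff.mp hQ
      obtain ⟨rs, hlen, hmem, hrs⟩ := hdepth
      have h1 := length_le_ringKrullDim_quotient rs hmem hrs Q ⟨w, by
        rintro rfl
        apply hprime.ne_top
        rw [hw, Submodule.colon_singleton_zero], fun a ha => by
        rw [hw, Submodule.mem_colon_singleton] at ha
        simpa using ha⟩
      have h2 := ringKrullDim_quotient_le_length Q xs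
        (fun y hy => hxs y (by simp [hy])) fun P hP hQP hxP =>
        h P hP (((Submodule.annihilator_top (R := A) (M := M)).symm.le.trans
          (IsAssociatedPrime.annihilator_le hQ)).trans hQP) (by
          simpa using ⟨hQP hxQ, hxP⟩)
      rw [hlen, List.length_cons] at h1
      have h3 : ((xs.length + 1 : ℕ) : WithBot ℕ∞) ≤ (xs.length : ℕ) := h1.trans h2
      have h4 : xs.length + 1 ≤ xs.length := by exact_mod_cast h3
      omega
    refine IsWeaklyRegular.cons hx (ih (fun y hy => hxs y (by simp [hy])) ?_ ?_)
    · intro P hP hann hP'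
      refine h P hP (fun a ha => hann ?_) ?_
      · rw [Module.mem_annihilator] at ha ⊢
        intro m
        obtain ⟨m, rfl⟩ := Submodule.Quotient.mk_surjective _ m
        rw [← Submodule.Quotient.mk_smul, ha, Submodule.Quotient.mk_zero]
      · have hxP : x ∈ P := hann (by
          rw [Module.mem_annihilator]
          intro m
          obtain ⟨m, rfl⟩ := Submodule.Quotient.mk_surjective _ m
          rw [← Submodule.Quotient.mk_smul, Submodule.Quotient.mk_eq_zero]
          exact Submodule.smul_mem_pointwise_smul _ _ _ trivial)
        simpa using ⟨hxP, hP'⟩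
    · exact exists_isRegular_quotSMulTop (hxs x (by simp)) hx _ (by simpa using hdepth)

/-- A family of `dim A` elements of the maximal ideal of a Cohen–Macaulay local ring that is
contained in no other prime is regular in every order. -/
theorem IsCohenMacaulayLocal.mem_span_of_mul_mem (hCM : IsCohenMacaulayLocal A)
    {ι : Type*} [Fintype ι] (hdim : ringKrullDim A = (Fintype.card ι : WithBot ℕ∞)) {w : ι → A}
    (hw : ∀ i, w i ∈ maximalIdeal A)
    (h : ∀ P : Ideal A, P.IsPrime → (∀ i, w i ∈ P) → P = maximalIdeal A) (i : ι) {a : A}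
    (ha : w i * a ∈ Ideal.span (w '' {i}ᶜ)) : a ∈ Ideal.span (w '' {i}ᶜ) := by
  classical
  -- With `w i` placed last, regularity says that `w i` is a nonzerodivisor modulo all the others.
  let l : List A := (Finset.univ.erase i).toList.map w
  have hl : Ideal.ofList l = Ideal.span (w '' {i}ᶜ) := by
    rw [Ideal.ofList]
    congr 1
    ext a
    simp [l]
  obtain ⟨rs, hrs, hreg, hlen⟩ := hCM
  have hreg' : IsWeaklyRegular A (l ++ [w i]) := by
    refine isWeaklyRegular_of_parameters (l ++ [w i]) ?_ ?_ ⟨rs, ?_, hrs, hreg⟩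
    · intro x hx
      rcases List.mem_append.mp hx with hx | hx
      · obtain ⟨j, -, rfl⟩ := List.mem_map.mp hx
        exact hw j
      · rw [List.mem_singleton.mp hx]
        exact hw i
    · intro P hP _ hx
      refine h P hP fun j => hx _ ?_
      by_cases hj : j = i
      · simp [hj]
      · exact List.mem_append_left _ (List.mem_map.mpr ⟨j, by simp [hj], rfl⟩)
    · rw [hdim] at hlen
      have : rs.length = Fintype.card ι := by exact_mod_cast hlen.symm
      have hpos : 0 < Fintype.card ι := Fintype.card_pos_iff.mpr ⟨i⟩
      rw [this]
      simp [l]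
      omega
  have h1 := ((isWeaklyRegular_append_iff A l [w i]).mp hreg').2
  rw [isWeaklyRegular_singleton_iff, hl] at h1
  have h2 := isSMulRegular_iff_right_eq_zero_of_smul.mp h1 (Submodule.Quotient.mk a)
  rw [← Submodule.Quotient.mk_smul, Submodule.Quotient.mk_eq_zero, Submodule.Quotient.mk_eq_zero]
    at h2
  simpa using h2 (by simpa using ha)

end CohenMacaulay

/-! ### Colengths of powers of parameters. -/

section Length

variable {A : Type*} [CommRing A]

/-- Additivity of colength along a nonzerodivisor modulo `T`. -/
theorem length_quotient_sup_span_mul (T : Ideal A) (c c' : A) (h : ∀ a, c * a ∈ T → a ∈ T) :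
    Module.length A (A ⧸ T ⊔ Ideal.span {c * c'}) =
      Module.length A (A ⧸ T ⊔ Ideal.span {c'}) + Module.length A (A ⧸ T ⊔ Ideal.span {c}) := by
  have hle : T ⊔ Ideal.span {c * c'} ≤ T ⊔ Ideal.span {c} :=
    sup_le_sup_left (Ideal.span_singleton_le_span_singleton.mpr (dvd_mul_right c c')) T
  have hmap : T ⊔ Ideal.span {c'} ≤
      Submodule.comap (LinearMap.mulLeft A c) (T ⊔ Ideal.span {c * c'}) := by
    refine sup_le (fun a ha => Ideal.mem_sup_left (S := T) (T.mul_mem_left c ha)) ?_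
    rw [Ideal.span_singleton_le_iff_mem]
    exact Ideal.mem_sup_right (Ideal.mem_span_singleton_self _)
  let f : (A ⧸ T ⊔ Ideal.span {c'}) →ₗ[A] A ⧸ T ⊔ Ideal.span {c * c'} :=
    Submodule.mapQ _ _ (LinearMap.mulLeft A c) hmap
  let g : (A ⧸ T ⊔ Ideal.span {c * c'}) →ₗ[A] A ⧸ T ⊔ Ideal.span {c} := Submodule.factor hle
  have hg : ∀ a, g (Submodule.Quotient.mk a) = Submodule.Quotient.mk a := fun _ => rfl
  refine Module.length_eq_add_of_exact f g ?_ (Submodule.factor_surjective hle) ?_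
  · rw [injective_iff_map_eq_zero]
    intro z hz
    obtain ⟨a, rfl⟩ := Submodule.Quotient.mk_surjective _ z
    rw [Submodule.mapQ_apply, Submodule.Quotient.mk_eq_zero] at hz
    rw [Submodule.Quotient.mk_eq_zero]
    obtain ⟨t, ht, s, hs, hts⟩ := Submodule.mem_sup.mp hz
    obtain ⟨u, rfl⟩ := Ideal.mem_span_singleton'.mp hs
    rw [LinearMap.mulLeft_apply] at hts
    have : a - u * c' ∈ T := h _ (by
      rw [mul_sub, ← hts, show t + u * (c * c') - c * (u * c') = t by ring]
      exact ht)
    rw [← sub_add_cancel a (u * c')]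
    exact Ideal.add_mem _ (Ideal.mem_sup_left this)
      (Ideal.mem_sup_right (Ideal.mul_mem_left _ _ (Ideal.mem_span_singleton_self _)))
  · intro z
    obtain ⟨a, rfl⟩ := Submodule.Quotient.mk_surjective _ z
    constructor
    · intro hz
      rw [hg, Submodule.Quotient.mk_eq_zero] at hz
      obtain ⟨t, ht, s, hs, rfl⟩ := Submodule.mem_sup.mp hz
      obtain ⟨u, rfl⟩ := Ideal.mem_span_singleton'.mp hs
      refine ⟨Submodule.Quotient.mk u, ?_⟩
      rw [Submodule.mapQ_apply, eq_comm, Submodule.Quotient.eq, LinearMap.mulLeft_apply]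
      exact Ideal.mem_sup_left (by rwa [mul_comm u c, add_sub_cancel_right])
    · rintro ⟨y, hy⟩
      obtain ⟨b, rfl⟩ := Submodule.Quotient.mk_surjective _ y
      rw [← hy, Submodule.mapQ_apply, hg, Submodule.Quotient.mk_eq_zero,
        LinearMap.mulLeft_apply]
      exact Ideal.mem_sup_right (Ideal.mul_mem_right _ _ (Ideal.mem_span_singleton_self _))

theorem length_quotient_sup_span_pow (T : Ideal A) (c : A) (h : ∀ a, c * a ∈ T → a ∈ T) (n : ℕ) :
    Module.length A (A ⧸ T ⊔ Ideal.span {c ^ n}) =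
      n * Module.length A (A ⧸ T ⊔ Ideal.span {c}) := by
  induction n with
  | zero =>
    rw [pow_zero, Ideal.span_singleton_one, sup_top_eq, Nat.cast_zero, zero_mul,
      Module.length_eq_zero_iff]
    exact Submodule.Quotient.subsingleton_iff.mpr rfl
  | succ n ih =>
    rw [pow_succ', length_quotient_sup_span_mul T c _ h, ih, Nat.cast_succ, add_mul, one_mul]

end Length

section CohenMacaulay

open IsLocalRing

variable {A : Type u} [CommRing A] [IsLocalRing A] [IsNoetherianRing A]

/-- The colength of the ideal of `q`-th powers of a system of parameters. -/
theorem IsCohenMacaulayLocal.length_quotient_span_pow (hCM : IsCohenMacaulayLocal A)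
    {ι : Type*} [Fintype ι] (hdim : ringKrullDim A = (Fintype.card ι : WithBot ℕ∞)) {x : ι → A}
    (hx : ∀ i, x i ∈ maximalIdeal A)
    (h : ∀ P : Ideal A, P.IsPrime → (∀ i, x i ∈ P) → P = maximalIdeal A) {q : ℕ} (hq : q ≠ 0) :
    Module.length A (A ⧸ Ideal.span (Set.range fun i => x i ^ q)) =
      (q ^ Fintype.card ι : ℕ) * Module.length A (A ⧸ Ideal.span (Set.range x)) := by
  classical
  -- The parameters are raised to the power `q` one at a time; each mixed family is again a system
  -- of parameters.
  have key : ∀ s : Finset ι, Module.length A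
      (A ⧸ Ideal.span (Set.range fun i => if i ∈ s then x i ^ q else x i)) =
      (q ^ s.card : ℕ) * Module.length A (A ⧸ Ideal.span (Set.range x)) := by
    intro s
    induction s using Finset.induction_on with
    | empty =>
      have hempty : (fun i => if i ∈ (∅ : Finset ι) then x i ^ q else x i) = x := by simp
      rw [hempty, Finset.card_empty, pow_zero, Nat.cast_one, one_mul]
    | insert i s hi ih =>
      let w : ι → A := fun j => if j ∈ s then x j ^ q else x j
      have hwi : w i = x i := by simp [w, hi]
      have hsup : ∀ v : ι → A, Ideal.span (Set.range v) =
          Ideal.span (v '' {i}ᶜ) ⊔ Ideal.span {v i} := fun v => by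
        rw [← Set.image_univ, ← Set.compl_union_self {i}, Set.image_union, Ideal.span_union,
          Set.image_singleton]
      have hinsert : Ideal.span (Set.range fun j => if j ∈ insert i s then x j ^ q else x j) =
          Ideal.span (w '' {i}ᶜ) ⊔ Ideal.span {w i ^ q} := by
        rw [hsup, hwi, if_pos (Finset.mem_insert_self i s)]
        congr 2
        refine Set.image_congr fun j hj => ?_
        have hj : j ≠ i := hj
        simp [w, hj]
      have hreg := fun a => hCM.mem_span_of_mul_mem (a := a) hdim (w := w) (fun j => by
        simp only [w]
        split_ifs
        · exact Ideal.pow_mem_of_mem _ (hx j) q (Nat.pos_of_ne_zero hq)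
        · exact hx j) (fun P hP hw => h P hP fun j => by
          have := hw j
          simp only [w] at this
          split_ifs at this
          · exact hP.mem_of_pow_mem q this
          · exact this) i
      rw [hinsert, length_quotient_sup_span_pow _ _ hreg, ← hsup, ih, Finset.card_insert_of_notMem hi,
        pow_succ, Nat.cast_mul, ← mul_assoc, mul_comm ((q : ℕ) : ℕ∞)]
  have huniv : (fun i => if i ∈ Finset.univ then x i ^ q else x i) = fun i => x i ^ q := by
    simp
  rw [← huniv, key Finset.univ, Finset.card_univ]

end CohenMacaulay

/-! ### Maps from power series rings, and freeness over them. -/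

section PowerSeriesHom

/-- Evaluation of power series at topologically nilpotent elements of an adically complete ring. -/
theorem exists_ringHom_mvPowerSeries {k R : Type*} [Field k] [CommRing R] (K : Ideal R)
    [IsAdicComplete K R] {d : ℕ} (σ : k →+* R) (x : Fin d → R) (hx : ∀ i, x i ∈ K) :
    ∃ φ : MvPowerSeries (Fin d) k →+* R, (∀ c, φ (MvPowerSeries.C c) = σ c) ∧
      ∀ i, φ (MvPowerSeries.X i) = x i := by
  let : WithIdeal R := ⟨K⟩
  let : UniformSpace k := ⊥
  have hK : IsAdic K := rfl
  obtain ⟨h1, h2⟩ := hK.isAdicComplete_iff.mp inferInstance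
  have : DiscreteTopology k := ⟨rfl⟩
  have hφ : Continuous σ := continuous_of_discreteTopology
  have ha : MvPowerSeries.HasEval x :=
    ⟨fun i => WithIdeal.isTopologicallyNilpotent_of_mem (hx i), by simp⟩
  refine ⟨MvPowerSeries.eval₂Hom hφ ha, fun c => ?_, fun i => ?_⟩
  · rw [MvPowerSeries.coe_eval₂Hom, MvPowerSeries.eval₂_C]
  · rw [MvPowerSeries.coe_eval₂Hom, MvPowerSeries.eval₂_X]

theorem mem_smul_top_pi_iff {P ι : Type*} [CommRing P] [Fintype ι] (I : Ideal P) (f : ι → P) :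
    f ∈ (I • ⊤ : Submodule P (ι → P)) ↔ ∀ i, f i ∈ I := by
  classical
  constructor
  · intro hf i
    have := Submodule.mem_map_of_mem (f := LinearMap.proj (R := P) (φ := fun _ : ι => P) i) hf
    rw [Submodule.map_smul''] at this
    exact Ideal.mul_le_right (I := Submodule.map _ _) (J := I) (by rwa [mul_comm])
  · intro h
    rw [pi_eq_sum_univ' f]
    exact Submodule.sum_mem _ fun i _ => Submodule.smul_mem_smul (h i) trivial

theorem isPrecomplete_pi {P ι : Type*} [CommRing P] [Fintype ι] (I : Ideal P) [IsPrecomplete I P] :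
    IsPrecomplete I (ι → P) := by
  refine ⟨fun f hf => ?_⟩
  have hex : ∀ i, ∃ L : P, ∀ n, f n i ≡ L [SMOD (I ^ n • ⊤ : Submodule P P)] := fun i => by
    refine IsPrecomplete.prec' _ fun {m n} hmn => ?_
    have := hf hmn
    rw [SModEq.sub_mem, mem_smul_top_pi_iff] at this
    rw [SModEq.sub_mem]
    simpa using this i
  choose L hL using hex
  refine ⟨L, fun n => ?_⟩
  rw [SModEq.sub_mem, mem_smul_top_pi_iff]
  intro i
  have := hL i n
  rw [SModEq.sub_mem] at this
  simpa using this

end PowerSeriesHom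

namespace MvPowerSeries

variable {k R : Type*} [Field k] {d : ℕ} [CommRing R] [Algebra (MvPowerSeries (Fin d) k) R]
  [Algebra k R] [IsScalarTower k (MvPowerSeries (Fin d) k) R]

theorem eq_zero_of_forall_mem_varPow {f : MvPowerSeries (Fin d) k}
    (h : ∀ q, q ≠ 0 → f ∈ varPow k d q) : f = 0 := by
  ext α
  refine (mem_varPow_iff f).mp (h ((∑ i, α i) + 1) (by omega)) α fun i => ?_
  exact Nat.lt_succ_of_le (Finset.single_le_sum (fun _ _ => Nat.zero_le _) (Finset.mem_univ i))

/-- Lifts of a `k`-basis of the fibre generate `R` by completeness. Modulo each `varPow` the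
resulting surjection is between spaces of equal dimension, hence injective, so a relation has
coefficients in every `varPow` and is zero. -/
theorem exists_basis {e : ℕ}
    [IsHausdorff (Ideal.span (Set.range X) : Ideal (MvPowerSeries (Fin d) k)) R]
    (he : ∀ q, q ≠ 0 → Module.finrank k (R ⧸ (varPow k d q).map
      (algebraMap (MvPowerSeries (Fin d) k) R)) = e * q ^ d) (he0 : e ≠ 0) :
    Nonempty (Module.Basis (Fin e) (MvPowerSeries (Fin d) k) R) := by
  classical
  let φ := algebraMap (MvPowerSeries (Fin d) k) R
  let 𝔛 : Ideal (MvPowerSeries (Fin d) k) := Ideal.span (Set.range X)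
  have h𝔛 : varPow k d 1 = 𝔛 := by simp [varPow, 𝔛]
  have hfin : Module.finrank k (R ⧸ 𝔛.map φ) = e := by
    rw [← h𝔛, he 1 one_ne_zero, one_pow, mul_one]
  -- An infinite-dimensional space has `finrank` zero, so `e ≠ 0` is what guarantees finiteness.
  have : FiniteDimensional k (R ⧸ 𝔛.map φ) := .of_finrank_pos (by omega)
  let b := Module.finBasisOfFinrankEq k _ hfin
  choose v hv using fun i => Ideal.Quotient.mk_surjective (I := 𝔛.map φ) (b i)
  let f : (Fin e → MvPowerSeries (Fin d) k) →ₗ[MvPowerSeries (Fin d) k] R :=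
    Fintype.linearCombination _ v
  have hf : ∀ g, f g = ∑ i, φ (g i) * v i := fun g => by
    simp [f, Fintype.linearCombination_apply, Algebra.smul_def, φ]
  have hsurj : Function.Surjective f := by
    have := isPrecomplete_pi (ι := Fin e) 𝔛
    refine surjective_of_mkQ_comp_surjective (I := 𝔛) fun z => ?_
    obtain ⟨r, rfl⟩ := Submodule.Quotient.mk_surjective _ z
    refine ⟨fun i => C (b.repr (Ideal.Quotient.mk _ r) i), ?_⟩
    rw [LinearMap.comp_apply, Submodule.mkQ_apply, Submodule.Quotient.eq, Ideal.smul_top_eq_map,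
      Submodule.restrictScalars_mem]
    rw [← Ideal.Quotient.eq_zero_iff_mem, map_sub, sub_eq_zero, hf, map_sum]
    conv_rhs => rw [← b.sum_repr (Ideal.Quotient.mk _ r)]
    refine Finset.sum_congr rfl fun i _ => ?_
    rw [map_mul, hv, Algebra.smul_def]
    congr 1
    rw [IsScalarTower.algebraMap_apply k R (R ⧸ 𝔛.map φ),
      IsScalarTower.algebraMap_apply k (MvPowerSeries (Fin d) k) R]
    rfl
  have hinj : Function.Injective f := by
    rw [injective_iff_map_eq_zero]
    intro g hg
    funext i
    refine eq_zero_of_forall_mem_varPow fun q hq => ?_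
    let V := varPow k d q
    let ψ : MvPowerSeries (Fin d) k ⧸ V →+* R ⧸ V.map φ :=
      Ideal.quotientMap _ φ Ideal.le_comap_map
    have hψ : ∀ a, ψ (Ideal.Quotient.mk V a) = Ideal.Quotient.mk _ (φ a) := fun a =>
      Ideal.quotientMap_mk
    let F : (Fin e → MvPowerSeries (Fin d) k ⧸ V) →ₗ[k] R ⧸ V.map φ :=
      { toFun := fun h => ∑ i, ψ (h i) * Ideal.Quotient.mk _ (v i)
        map_add' := fun h h' => by simp [add_mul, Finset.sum_add_distrib]
        map_smul' := fun c h => by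
          rw [RingHom.id_apply, Finset.smul_sum]
          refine Finset.sum_congr rfl fun i _ => ?_
          obtain ⟨a, ha⟩ := Ideal.Quotient.mk_surjective (h i)
          rw [Pi.smul_apply, ← ha, ← smul_mul_assoc]
          congr 1
          rw [← Ideal.Quotient.mkₐ_eq_mk k, ← map_smul, Ideal.Quotient.mkₐ_eq_mk, hψ, hψ,
            ← Ideal.Quotient.mkₐ_eq_mk k, ← map_smul]
          congr 1
          exact map_smul (IsScalarTower.toAlgHom k (MvPowerSeries (Fin d) k) R) c a }
    have hF : ∀ h : Fin e → MvPowerSeries (Fin d) k,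
        F (fun i => Ideal.Quotient.mk V (h i)) = Ideal.Quotient.mk _ (f h) := fun h => by
      rw [hf, map_sum]
      change ∑ i : Fin e, ψ _ * _ = _
      refine Finset.sum_congr rfl fun i _ => ?_
      rw [map_mul, hψ]
    have hFsurj : Function.Surjective F := fun z => by
      obtain ⟨r, rfl⟩ := Ideal.Quotient.mk_surjective z
      obtain ⟨h, rfl⟩ := hsurj r
      exact ⟨_, hF h⟩
    have : FiniteDimensional k (R ⧸ V.map φ) := .of_finrank_pos (by
      rw [he q hq]
      positivity)
    have hFinj : Function.Injective F := by
      refine (LinearMap.injective_iff_surjective_of_finrank_eq_finrank ?_).mpr hFsurj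
      rw [he q hq, Module.finrank_pi_fintype]
      simp [V, finrank_quotient_varPow]
    have h0 := hF g
    rw [hg, map_zero] at h0
    exact Ideal.Quotient.eq_zero_iff_mem.mp
      (congrFun (hFinj (h0.trans (map_zero F).symm)) i)
  exact ⟨.ofEquivFun (LinearEquiv.ofBijective f ⟨hinj, hsurj⟩).symm⟩

end MvPowerSeries

/-! ### Length as dimension over a coefficient field. -/

section LengthFinrank

open IsLocalRing

/-- Over a local algebra over a field `k` with residue field `k`, length equals `k`-dimension. -/
theorem IsFiniteLength.length_eq_length {k R M : Type*} [Field k] [CommRing R] [IsLocalRing R]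
    [AddCommGroup M] [Module R M] (hM : IsFiniteLength R M) [Algebra k R]
    (hk : ∀ r : R, ∃ c : k, r - algebraMap k R c ∈ maximalIdeal R) :
    ∀ [Module k M] [IsScalarTower k R M], Module.length k M = Module.length R M := by
  induction hM with
  | of_subsingleton =>
    intro _ _
    rw [Module.length_eq_zero, Module.length_eq_zero]
  | @of_simple_quotient M _ _ N hN _ ih =>
    intro _ _
    have h1 := Module.length_eq_add_of_exact N.subtype N.mkQ N.injective_subtype N.mkQ_surjective
      (LinearMap.exact_subtype_mkQ N)
    have h2 := Module.length_eq_add_of_exact (N.subtype.restrictScalars k)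
      (N.mkQ.restrictScalars k) N.injective_subtype N.mkQ_surjective
      (LinearMap.exact_subtype_mkQ N)
    rw [h1, h2, ih]
    congr 1
    obtain ⟨I, hI, ⟨f⟩⟩ := isSimpleModule_iff_quot_maximal.mp hN
    obtain rfl := eq_maximalIdeal hI
    rw [f.length_eq, (f.restrictScalars k).length_eq]
    have hsurj : Function.Surjective (algebraMap k (R ⧸ maximalIdeal R)) := fun z => by
      obtain ⟨r, rfl⟩ := Ideal.Quotient.mk_surjective z
      obtain ⟨c, hc⟩ := hk r
      exact ⟨c, (Ideal.Quotient.eq.mpr hc).symm⟩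
    rw [Module.length_eq_of_surjective hsurj,
      Module.length_eq_of_surjective (S := R) (R := R ⧸ maximalIdeal R)
        Ideal.Quotient.mk_surjective]

theorem exists_maximalIdeal_pow_le_of_pow_mem {A : Type*} [CommRing A] [IsLocalRing A]
    [IsNoetherianRing A] {s : Set A} {N : ℕ} (hN : maximalIdeal A ^ N ≤ Ideal.span s) {K : Ideal A}
    {q : ℕ} (h : ∀ a ∈ s, a ^ q ∈ K) : ∃ N', maximalIdeal A ^ N' ≤ K := by
  obtain ⟨n, hn⟩ := Ideal.exists_pow_le_of_le_radical_of_fg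
    (hN.trans (Ideal.span_le.mpr fun a ha => ⟨q, h a ha⟩) : _ ≤ K.radical)
    (IsNoetherian.noetherian _)
  exact ⟨N * n, by rwa [pow_mul]⟩

theorem isFiniteLength_quotient {A : Type*} [CommRing A] [IsLocalRing A] [IsNoetherianRing A]
    {I : Ideal A} {N : ℕ} (hI : maximalIdeal A ^ N ≤ I) : IsFiniteLength A (A ⧸ I) := by
  by_cases htop : I = ⊤
  · have : Subsingleton (A ⧸ I) := Ideal.Quotient.subsingleton_iff.mpr htop
    exact .of_subsingleton
  have : Nontrivial (A ⧸ I) := Ideal.Quotient.nontrivial_iff.mpr htop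
  have : IsLocalRing (A ⧸ I) := .of_surjective' (Ideal.Quotient.mk I) Ideal.Quotient.mk_surjective
  have : IsArtinianRing (A ⧸ I) := by
    rw [isArtinianRing_iff_isNilpotent_maximalIdeal]
    refine ⟨N, ?_⟩
    have hmap : maximalIdeal (A ⧸ I) = (maximalIdeal A).map (Ideal.Quotient.mk I) := by
      rw [← eq_maximalIdeal (Ideal.comap_isMaximal_of_surjective (Ideal.Quotient.mk I)
        Ideal.Quotient.mk_surjective (K := maximalIdeal (A ⧸ I))),
        Ideal.map_comap_of_surjective _ Ideal.Quotient.mk_surjective]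
    rw [hmap, ← Ideal.map_pow, Ideal.zero_eq_bot, Ideal.map_eq_bot_iff_le_ker, Ideal.mk_ker]
    exact hI
  rw [← Module.length_ne_top_iff,
    Module.length_eq_of_surjective (R := A ⧸ I) Ideal.Quotient.mk_surjective]
  exact Module.length_ne_top

theorem toNat_length_quotient_ne_zero {A : Type*} [CommRing A] [IsLocalRing A] [IsNoetherianRing A]
    {I : Ideal A} {N : ℕ} (hI : maximalIdeal A ^ N ≤ I) (hI' : I ≤ maximalIdeal A) :
    (Module.length A (A ⧸ I)).toNat ≠ 0 := by
  intro h0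
  rw [ENat.toNat_eq_zero, or_iff_left (Module.length_ne_top_iff.mpr (isFiniteLength_quotient hI)),
    Module.length_eq_zero_iff, Ideal.Quotient.subsingleton_iff] at h0
  exact (maximalIdeal.isMaximal A).ne_top (top_le_iff.mp (h0 ▸ hI'))

end LengthFinrank

/-! ### The completion as a finite free algebra over a power series ring. -/

namespace AdicCompletion

open IsLocalRing

variable {A : Type u} [CommRing A] [IsLocalRing A] [IsNoetherianRing A]

/-- The completion of `A` at its maximal ideal. -/
local notation "Â" => AdicCompletion (maximalIdeal A) A

theorem exists_sub_algebraMap_mem_map_pow (N : ℕ) (r : Â) :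
    ∃ a : A, r - algebraMap A Â a ∈ (maximalIdeal A ^ N).map (algebraMap A Â) := by
  obtain ⟨a, ha⟩ := Ideal.Quotient.mk_surjective (r.1 N)
  refine ⟨a, ?_⟩
  rw [← Submodule.restrictScalars_mem A, ← Ideal.smul_top_eq_map,
    pow_smul_top_eq_ker_eval (maximalIdeal A).fg_of_isNoetherianRing, LinearMap.mem_ker, map_sub,
    sub_eq_zero, algebraMap_apply]
  exact ha.symm

/-- Since `I` contains a power of the maximal ideal, membership is visible in the quotient by that
power, which the completion maps onto. -/
theorem algebraMap_mem_map_iff {A : Type u} [CommRing A] [IsLocalRing A] {I : Ideal A} {N : ℕ} (hI : maximalIdeal A ^ N ≤ I) (a : A) :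
    algebraMap A (AdicCompletion (maximalIdeal A) A) a ∈
      I.map (algebraMap A (AdicCompletion (maximalIdeal A) A)) ↔ a ∈ I := by
  refine ⟨fun h => ?_, Ideal.mem_map_of_mem _⟩
  have h1 := Ideal.mem_map_of_mem (evalₐ (maximalIdeal A) N).toRingHom h
  rw [Ideal.map_map] at h1
  have h2 : (evalₐ (maximalIdeal A) N).toRingHom.comp
      (algebraMap A (AdicCompletion (maximalIdeal A) A)) =
      Ideal.Quotient.mk (maximalIdeal A ^ N) := by
    ext a
    exact (evalₐ (maximalIdeal A) N).commutes a
  rw [h2, ← RingHom.comp_apply, h2, Ideal.mem_quotient_iff_mem hI] at h1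
  exact h1

theorem quotient_map_surjective {I : Ideal A} {N : ℕ} (hI : maximalIdeal A ^ N ≤ I) :
    Function.Surjective (algebraMap A (Â ⧸ I.map (algebraMap A Â))) := fun z => by
  obtain ⟨r, rfl⟩ := Ideal.Quotient.mk_surjective z
  obtain ⟨a, ha⟩ := exists_sub_algebraMap_mem_map_pow N r
  exact ⟨a, (Ideal.Quotient.eq.mpr (Ideal.map_mono hI ha)).symm⟩

theorem length_quotient_map {I : Ideal A} {N : ℕ} (hI : maximalIdeal A ^ N ≤ I) :
    Module.length Â (Â ⧸ I.map (algebraMap A Â)) = Module.length A (A ⧸ I) := by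
  have hsurj := quotient_map_surjective hI
  rw [Module.length_eq_of_surjective (S := Â) (R := Â ⧸ I.map (algebraMap A Â))
    Ideal.Quotient.mk_surjective, ← Module.length_eq_of_surjective hsurj]
  refine (LinearEquiv.length_eq ?_).symm
  refine LinearEquiv.trans (Submodule.quotEquivOfEq _ _ ?_)
    ((Algebra.linearMap A (Â ⧸ I.map (algebraMap A Â))).quotKerEquivOfSurjective hsurj)
  ext a
  rw [LinearMap.mem_ker, Algebra.linearMap_apply,
    IsScalarTower.algebraMap_apply A Â (Â ⧸ I.map (algebraMap A Â)),
    Ideal.Quotient.algebraMap_eq, Ideal.Quotient.eq_zero_iff_mem, algebraMap_mem_map_iff hI]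

/-- Lengths over `A` are dimensions over a coefficient field of the completion. -/
theorem length_quotient_eq_finrank {k : Type*} [Field k] [Algebra k Â]
    (hk : ∀ r : Â, ∃ c : k, r - algebraMap k Â c ∈ maximalIdeal Â)
    {I : Ideal A} {N : ℕ} (hI : maximalIdeal A ^ N ≤ I) :
    Module.length A (A ⧸ I) = Module.finrank k (Â ⧸ I.map (algebraMap A Â)) := by
  have hlen := length_quotient_map hI
  have hfin : IsFiniteLength Â (Â ⧸ I.map (algebraMap A Â)) := by
    rw [← Module.length_ne_top_iff, hlen, Module.length_ne_top_iff]
    exact isFiniteLength_quotient hI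
  have hlen' := hfin.length_eq_length hk
  have : IsNoetherian k (Â ⧸ I.map (algebraMap A Â)) := by
    refine (isFiniteLength_iff_isNoetherian_isArtinian.mp ?_).1
    rwa [← Module.length_ne_top_iff, hlen', Module.length_ne_top_iff]
  rw [← hlen, ← hlen', Module.length_eq_finrank]

/-- The completion of a local ring of characteristic `p` has a coefficient field. -/
theorem exists_ringHom_residueField (p : ℕ) [Fact p.Prime] [CharP A p] :
    ∃ σ : ResidueField A →+* Â,
      ∀ r : Â, ∃ c : ResidueField A, r - σ c ∈ maximalIdeal Â := by
  let : Algebra (ZMod p) A := ZMod.algebra A p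
  let : Algebra (ZMod p) (ResidueField A) := inferInstance
  -- Formal smoothness over the prime field lifts the identity of the residue field to the
  -- completion.
  have := formallySmooth_of_perfectField (ZMod p) (ResidueField A)
  let f : ResidueField A →ₐ[ZMod p] A ⧸ maximalIdeal A := AlgHom.id _ _
  obtain ⟨g, hg⟩ := Algebra.FormallySmooth.exists_adicCompletionEvalOneₐ_comp_eq f
  refine ⟨g.toRingHom, fun r => ⟨evalOneₐ (maximalIdeal A) r, ?_⟩⟩
  rw [maximalIdeal_eq_map, ← ker_evalOneₐ_eq_map _ (maximalIdeal A).fg_of_isNoetherianRing,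
    RingHom.mem_ker, map_sub, sub_eq_zero]
  exact (congrArg (fun h => h (evalOneₐ (maximalIdeal A) r)) hg).symm

/-- Freeness follows from the exact growth `ℓ(A/(x_1^q, …, x_d^q)) = q^d ℓ(A/(x))`. This is where
the Cohen–Macaulay property enters. -/
theorem exists_algebra_mvPowerSeries (p : ℕ) [Fact p.Prime] [CharP A p]
    (hCM : IsCohenMacaulayLocal A) {d : ℕ} (hdim : ringKrullDim A = (d : WithBot ℕ∞))
    {x : Fin d → A} (hx : ∀ i, x i ∈ maximalIdeal A) {N : ℕ}
    (hN : maximalIdeal A ^ N ≤ Ideal.span (Set.range x)) :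
    ∃ (_ : Algebra (ResidueField A) Â) (_ : Algebra (MvPowerSeries (Fin d) (ResidueField A)) Â)
      (_ : IsScalarTower (ResidueField A) (MvPowerSeries (Fin d) (ResidueField A)) Â),
      (∀ i, algebraMap (MvPowerSeries (Fin d) (ResidueField A)) Â (MvPowerSeries.X i) =
        algebraMap A Â (x i)) ∧
      (∀ (I : Ideal A) (N : ℕ), maximalIdeal A ^ N ≤ I → Module.length A (A ⧸ I) =
        Module.finrank (ResidueField A) (Â ⧸ I.map (algebraMap A Â))) ∧
      Nonempty (Module.Basis (Fin (Module.length A (A ⧸ Ideal.span (Set.range x))).toNat)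
        (MvPowerSeries (Fin d) (ResidueField A)) Â) := by
  obtain ⟨σ, hσ⟩ := exists_ringHom_residueField (A := A) p
  have hxÂ : ∀ i, algebraMap A Â (x i) ∈ maximalIdeal Â := fun i => by
    rw [maximalIdeal_eq_map]
    exact Ideal.mem_map_of_mem _ (hx i)
  obtain ⟨φ, hφC, hφX⟩ := exists_ringHom_mvPowerSeries (maximalIdeal Â) σ _ hxÂ
  let ik : Algebra (ResidueField A) Â := σ.toAlgebra
  let iP : Algebra (MvPowerSeries (Fin d) (ResidueField A)) Â := φ.toAlgebra
  have itower : IsScalarTower (ResidueField A) (MvPowerSeries (Fin d) (ResidueField A)) Â :=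
    .of_algebraMap_eq fun c => (hφC c).symm
  have hlen : ∀ (I : Ideal A) (N : ℕ), maximalIdeal A ^ N ≤ I → Module.length A (A ⧸ I) =
      Module.finrank (ResidueField A) (Â ⧸ I.map (algebraMap A Â)) :=
    fun I N hI => length_quotient_eq_finrank hσ hI
  refine ⟨ik, iP, itower, hφX, hlen, ?_⟩
  have : IsHausdorff (Ideal.span (Set.range MvPowerSeries.X) :
      Ideal (MvPowerSeries (Fin d) (ResidueField A))) Â := by
    refine IsHausdorff.of_map (J := maximalIdeal Â) ?_
    rw [Ideal.map_span, Ideal.span_le]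
    rintro _ ⟨_, ⟨i, rfl⟩, rfl⟩
    exact (hφX i).symm ▸ hxÂ i
  have hJ : Module.length A (A ⧸ Ideal.span (Set.range x)) ≠ ⊤ :=
    Module.length_ne_top_iff.mpr (isFiniteLength_quotient hN)
  refine MvPowerSeries.exists_basis (fun q hq => ?_) ?_
  · have hmap : (MvPowerSeries.varPow (ResidueField A) d q).map (algebraMap _ Â) =
        (Ideal.span (Set.range fun i => x i ^ q)).map (algebraMap A Â) := by
      rw [MvPowerSeries.varPow, Ideal.map_span, Ideal.map_span, ← Set.range_comp, ← Set.range_comp]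
      congr 2
      funext i
      simp only [Function.comp_apply, map_pow]
      exact congrArg (· ^ q) (hφX i)
    have hprime : ∀ P : Ideal A, P.IsPrime → (∀ i, x i ∈ P) → P = maximalIdeal A :=
      fun P hP hxP => le_antisymm (le_maximalIdeal hP.ne_top) (hP.le_of_pow_le (hN.trans (by
        rw [Ideal.span_le]
        rintro _ ⟨i, rfl⟩
        exact hxP i)))
    obtain ⟨N', hN'⟩ : ∃ N', maximalIdeal A ^ N' ≤ Ideal.span (Set.range fun i => x i ^ q) := by
      refine exists_maximalIdeal_pow_le_of_pow_mem hN (q := q) ?_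
      rintro _ ⟨i, rfl⟩
      exact Ideal.subset_span ⟨i, rfl⟩
    have h1 := hCM.length_quotient_span_pow (by simpa using hdim) hx hprime hq
    rw [hlen _ _ hN', ← hmap, ← ENat.natCast_toNat hJ, Fintype.card_fin] at h1
    rw [mul_comm]
    exact_mod_cast h1
  · refine toNat_length_quotient_ne_zero hN ?_
    rw [Ideal.span_le]
    rintro _ ⟨i, rfl⟩
    exact hx i

end AdicCompletion

/-! ### Colengths of powers of the ideal of variables. -/

namespace MvPowerSeries

variable {k : Type*} [Field k] {d : ℕ}

theorem mem_span_range_X_pow_iff (n : ℕ) (f : MvPowerSeries (Fin d) k) :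
    f ∈ (Ideal.span (Set.range X) : Ideal (MvPowerSeries (Fin d) k)) ^ n ↔
      ∀ α ∈ {α : Fin d →₀ ℕ | α.degree < n}, coeff α f = 0 := by
  classical
  have hmap : (Ideal.span (Set.range X) : Ideal (MvPowerSeries (Fin d) k)) =
      (MvPolynomial.idealOfVars (Fin d) k).map MvPolynomial.coeToMvPowerSeries.ringHom := by
    rw [Ideal.map_span, ← Set.range_comp]
    congr 2
    funext i
    simp
  have hT : Finsupp.degree ⁻¹' {n} =
      ((Finset.univ.finsuppAntidiag n : Finset (Fin d →₀ ℕ)) : Set (Fin d →₀ ℕ)) := by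
    ext α
    simp [Finset.mem_finsuppAntidiag, Finsupp.degree_eq_sum]
  rw [hmap, ← Ideal.map_pow, MvPolynomial.pow_idealOfVars_eq_span, Ideal.map_span, Set.image_image]
  simp only [MvPolynomial.coeToMvPowerSeries.ringHom_apply, MvPolynomial.coe_monomial]
  rw [hT, mem_span_monomial_iff]
  refine forall_congr' fun α => ?_
  rw [not_imp_comm, Set.mem_ofPred_eq]
  refine imp_congr_left ?_
  rw [not_iff_comm, not_lt]
  constructor
  · intro hn
    obtain ⟨t, ht, htn⟩ := Finsupp.exists_le_degree_eq α n hn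
    exact ⟨t, by rw [← Finset.mem_coe, ← hT]; exact htn, ht⟩
  · rintro ⟨t, ht, htα⟩
    rw [← Finset.mem_coe, ← hT] at ht
    have ht : t.degree = n := ht
    exact ht ▸ Finsupp.degree_mono htα

theorem setOf_degree_lt_eq (d n : ℕ) : {α : Fin d →₀ ℕ | α.degree < n} =
    ((Finset.range n).biUnion fun i => Finset.univ.finsuppAntidiag i : Finset (Fin d →₀ ℕ)) := by
  ext α
  simp [Finset.mem_finsuppAntidiag, Finsupp.degree_eq_sum]

instance finite_setOf_degree_lt (d n : ℕ) : Finite {α : Fin d →₀ ℕ | α.degree < n} := by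
  rw [setOf_degree_lt_eq]
  infer_instance

theorem card_setOf_degree_lt (d n : ℕ) :
    Nat.card {α : Fin d →₀ ℕ | α.degree < n + 1} = (n + d).choose d := by
  rw [setOf_degree_lt_eq, Nat.card_coe_set_eq, Set.ncard_coe_finset, Finset.card_biUnion]
  · simp only [Finset.card_finsuppAntidiag_nat_eq_multichoose, Finset.card_univ, Fintype.card_fin]
    rw [Nat.sum_range_multichoose]
  · intro i _ j _ hij
    rw [Function.onFun, Finset.disjoint_left]
    intro α hi hj
    rw [Finset.mem_finsuppAntidiag] at hi hj
    exact hij (hi.1.symm.trans hj.1)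

theorem finrank_quotient_span_range_X_pow (n : ℕ) : Module.finrank k (MvPowerSeries (Fin d) k ⧸
    (Ideal.span (Set.range X) : Ideal (MvPowerSeries (Fin d) k)) ^ (n + 1)) = (n + d).choose d := by
  rw [finrank_quotient_eq_card _ _ (mem_span_range_X_pow_iff (n + 1)), card_setOf_degree_lt]

instance (n : ℕ) : FiniteDimensional k (MvPowerSeries (Fin d) k ⧸
    (Ideal.span (Set.range X) : Ideal (MvPowerSeries (Fin d) k)) ^ n) :=
  finiteDimensional_quotient _ _ (mem_span_range_X_pow_iff n)

end MvPowerSeries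

/-! ### Hilbert–Kunz and Hilbert functions, transferred back to `A`. -/

section HilbertKunz

open IsLocalRing

variable {A : Type u} [CommRing A] [IsLocalRing A] [IsNoetherianRing A]

/-- The Hilbert–Kunz multiplicity of an ideal `I` with `I ^ 2 ⊆ (x) ⊆ I`, where `x` is a system of
parameters of a Cohen–Macaulay ring, exists and is at least half of the colength of `(x)`. -/
theorem IsCohenMacaulayLocal.exists_tendsto_hilbertKunzSeq (p : ℕ) [Fact p.Prime] [CharP A p]
    (hCM : IsCohenMacaulayLocal A) {d : ℕ} (hd : 1 ≤ d)
    (hdim : ringKrullDim A = (d : WithBot ℕ∞))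
    {x : Fin d → A} (hx : ∀ i, x i ∈ maximalIdeal A) {N : ℕ}
    (hN : maximalIdeal A ^ N ≤ Ideal.span (Set.range x)) {I : Ideal A}
    (hxI : Ideal.span (Set.range x) ≤ I) (hI : I ^ 2 ≤ Ideal.span (Set.range x)) :
    ∃ L : ℝ, Tendsto (hilbertKunzSeq p d I) atTop (𝓝 L) ∧
      colength (Ideal.span (Set.range x)) / 2 ≤ L := by
  obtain ⟨_, _, _, hX, hlen, ⟨b⟩⟩ :=
    AdicCompletion.exists_algebra_mvPowerSeries p hCM hdim hx hN
  let R := AdicCompletion (maximalIdeal A) A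
  let P := MvPowerSeries (Fin d) (ResidueField A)
  have : CharP (ResidueField A) p := by
    rw [CharP.charP_iff_prime_eq_zero Fact.out, ← map_natCast (residue A), CharP.cast_eq_zero,
      map_zero]
  -- Only the image of `I`, not the ideal it generates: the q-th powers of its elements already
  -- generate the extension of `I^{[q]}`.
  let S : Set R := algebraMap A R '' (I : Set A)
  have hspan : Ideal.span (Set.range fun i => algebraMap P R (MvPowerSeries.X i)) =
      (Ideal.span (Set.range x)).map (algebraMap A R) := by
    rw [Ideal.map_span, ← Set.range_comp]
    exact congrArg (fun f => Ideal.span (Set.range f)) (funext hX)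
  have hpos : (Module.length A (A ⧸ Ideal.span (Set.range x))).toNat ≠ 0 := by
    refine toNat_length_quotient_ne_zero hN ?_
    rw [Ideal.span_le]
    rintro _ ⟨i, rfl⟩
    exact hx i
  have : Nonempty (Fin (Module.length A (A ⧸ Ideal.span (Set.range x))).toNat) :=
    ⟨⟨0, Nat.pos_of_ne_zero hpos⟩⟩
  obtain ⟨L, hL, hle⟩ := exists_tendsto_finrank_quotient_powSpan p hd b (S := S)
    (fun i => ⟨x i, hxI (Ideal.subset_span ⟨i, rfl⟩), (hX i).symm⟩) (by
      rintro _ ⟨a, ha, rfl⟩ _ ⟨c, hc, rfl⟩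
      rw [hspan, ← map_mul]
      exact Ideal.mem_map_of_mem _ (hI (by rw [pow_two]; exact Ideal.mul_mem_mul ha hc)))
  refine ⟨L, hL.congr fun t => ?_, by simpa [colength] using hle⟩
  have hmap : powSpan S (p ^ t) = (frobeniusPower I (p ^ t)).map (algebraMap A R) := by
    rw [powSpan, frobeniusPower, Ideal.map_span, Set.image_image, Set.image_image]
    simp only [map_pow]
  obtain ⟨N', hN'⟩ : ∃ N', maximalIdeal A ^ N' ≤ frobeniusPower I (p ^ t) :=
    exists_maximalIdeal_pow_le_of_pow_mem hN (q := p ^ t) fun a ha =>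
      Ideal.subset_span ⟨a, hxI (Ideal.subset_span ha), rfl⟩
  rw [hilbertKunzSeq, colength, hlen _ _ hN', hmap, ENat.toNat_natCast]

/-- The Hilbert function of a system of parameters of a Cohen–Macaulay ring. -/
theorem IsCohenMacaulayLocal.colength_pow (p : ℕ) [Fact p.Prime] [CharP A p]
    (hCM : IsCohenMacaulayLocal A) {d : ℕ} (hdim : ringKrullDim A = (d : WithBot ℕ∞))
    {x : Fin d → A} (hx : ∀ i, x i ∈ maximalIdeal A) {N : ℕ}
    (hN : maximalIdeal A ^ N ≤ Ideal.span (Set.range x)) (n : ℕ) :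
    colength (Ideal.span (Set.range x) ^ (n + 1)) =
      colength (Ideal.span (Set.range x)) * (n + d).choose d := by
  obtain ⟨_, _, _, hX, hlen, ⟨b⟩⟩ :=
    AdicCompletion.exists_algebra_mvPowerSeries p hCM hdim hx hN
  let R := AdicCompletion (maximalIdeal A) A
  let P := MvPowerSeries (Fin d) (ResidueField A)
  have hmap : (Ideal.span (Set.range x) ^ (n + 1)).map (algebraMap A R) =
      ((Ideal.span (Set.range MvPowerSeries.X) : Ideal P) ^ (n + 1)).map (algebraMap P R) := by
    rw [Ideal.map_pow, Ideal.map_pow, Ideal.map_span, Ideal.map_span, ← Set.range_comp,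
      ← Set.range_comp]
    exact congrArg (fun f => Ideal.span (Set.range f) ^ (n + 1)) (funext fun i => (hX i).symm)
  have hpow : maximalIdeal A ^ (N * (n + 1)) ≤ Ideal.span (Set.range x) ^ (n + 1) := by
    rw [pow_mul]
    exact Ideal.pow_right_mono hN _
  rw [colength, hlen _ _ hpow, hmap, ENat.toNat_natCast, b.finrank_quotient_map,
    MvPowerSeries.finrank_quotient_span_range_X_pow, Fintype.card_fin, Nat.cast_mul, colength]

end HilbertKunz

/-! ### The multiplicity as the colength of a parameter reduction. -/

section Multiplicity

open IsLocalRing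

theorem tendsto_factorial_div_pow_mul_choose (d a b : ℕ) :
    Tendsto (fun n : ℕ => (d.factorial : ℝ) / ((n + a : ℕ) : ℝ) ^ d * ((n + b).choose d : ℝ))
      atTop (𝓝 1) := by
  have h1 : Tendsto (fun n : ℕ => ((n.choose d : ℝ) / ((n : ℝ) ^ d / d.factorial))) atTop (𝓝 1) :=
    (Asymptotics.isEquivalent_iff_tendsto_one (by
      filter_upwards [eventually_gt_atTop 0] with n hn
      have := d.factorial_pos
      positivity)).mp (isEquivalent_choose d)
  have h2 := (tendsto_add_atTop_iff_nat b).mpr h1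
  have h3 : Tendsto (fun n : ℕ => (((n : ℝ) / (n + a)) / ((n : ℝ) / (n + b))) ^ d) atTop (𝓝 1) := by
    simpa using ((tendsto_natCast_div_add_atTop (a : ℝ)).div
      (tendsto_natCast_div_add_atTop (b : ℝ)) one_ne_zero).pow d
  have h4 := h3.mul h2
  rw [one_mul] at h4
  refine h4.congr' ?_
  filter_upwards [eventually_gt_atTop 0] with n hn
  have hn' : (0 : ℝ) < n := by exact_mod_cast hn
  have hd' : (d.factorial : ℝ) ≠ 0 := by exact_mod_cast d.factorial_ne_zero
  have hab : (n : ℝ) / (n + a) / (n / (n + b)) = (n + b) / (n + a) := by field_simp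
  rw [hab, div_pow]
  push_cast
  field_simp

variable {A : Type u} [CommRing A] [IsLocalRing A] [IsNoetherianRing A]

theorem colength_anti {I K : Ideal A} {N : ℕ} (hI : maximalIdeal A ^ N ≤ I) (hIK : I ≤ K) :
    colength K ≤ colength I := by
  rw [colength, colength]
  exact_mod_cast ENat.toNat_le_toNat
    (Module.length_le_of_surjective (Submodule.factor hIK) (Submodule.factor_surjective hIK))
    (Module.length_ne_top_iff.mpr (isFiniteLength_quotient hI))

theorem Ideal.pow_add_eq_of_reduction {A : Type u} [CommRing A] {J I : Ideal A} {r : ℕ}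
    (h : I ^ (r + 1) = J * I ^ r) (m : ℕ) : I ^ (r + m) = J ^ m * I ^ r := by
  induction m with
  | zero => simp
  | succ m ih => rw [← add_assoc, pow_succ, ih, mul_assoc, ← pow_succ, h, pow_succ, mul_assoc]

/-- The multiplicity of an ideal with a reduction generated by a system of parameters of a
Cohen–Macaulay ring is the colength of the reduction. -/
theorem IsCohenMacaulayLocal.tendsto_multiplicitySeq (p : ℕ) [Fact p.Prime] [CharP A p]
    (hCM : IsCohenMacaulayLocal A) {d : ℕ} (hdim : ringKrullDim A = (d : WithBot ℕ∞))
    {x : Fin d → A} (hx : ∀ i, x i ∈ maximalIdeal A) {N : ℕ}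
    (hN : maximalIdeal A ^ N ≤ Ideal.span (Set.range x)) {I : Ideal A}
    (hI : IsReduction (Ideal.span (Set.range x)) I) :
    Tendsto (multiplicitySeq d I) atTop (𝓝 (colength (Ideal.span (Set.range x)))) := by
  obtain ⟨hle, r, hr⟩ := hI
  let J := Ideal.span (Set.range x)
  have hpow : ∀ n, maximalIdeal A ^ (N * n) ≤ J ^ n := fun n => by
    rw [pow_mul]
    exact Ideal.pow_right_mono hN _
  have hupper : Tendsto (fun n : ℕ => colength J *
      ((d.factorial : ℝ) / ((n + r : ℕ) : ℝ) ^ d * ((n + (r + d)).choose d : ℝ)))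
      atTop (𝓝 (colength J)) := by
    simpa using (tendsto_factorial_div_pow_mul_choose d r (r + d)).const_mul (colength J)
  have hlower : Tendsto (fun n : ℕ => colength J *
      ((d.factorial : ℝ) / ((n + r : ℕ) : ℝ) ^ d * ((n + d).choose d : ℝ)))
      atTop (𝓝 (colength J)) := by
    simpa using (tendsto_factorial_div_pow_mul_choose d r d).const_mul (colength J)
  rw [← tendsto_add_atTop_iff_nat r]
  -- The squeeze is `J^(n+r+1) ⊆ I^(n+r+1) = J^(n+1) I^r ⊆ J^(n+1)`; the fixed shift `r` does not
  -- affect leading terms.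
  refine tendsto_of_tendsto_of_tendsto_of_le_of_le hlower hupper (fun n => ?_) fun n => ?_
  · have h1 : I ^ (n + r + 1) ≤ J ^ (n + 1) := by
      rw [show n + r + 1 = r + (n + 1) by ring, Ideal.pow_add_eq_of_reduction hr]
      exact Ideal.mul_le_left (I := J ^ (n + 1)) (J := I ^ r)
    have h2 := colength_anti ((hpow (n + r + 1)).trans (Ideal.pow_right_mono hle _)) h1
    rw [hCM.colength_pow p hdim hx hN] at h2
    dsimp only [multiplicitySeq]
    rw [mul_left_comm]
    gcongr
  · have h2 := colength_anti (hpow (n + r + 1)) (Ideal.pow_right_mono hle (n + r + 1))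
    rw [hCM.colength_pow p hdim hx hN, add_assoc n r d] at h2
    dsimp only [multiplicitySeq]
    rw [mul_left_comm]
    gcongr

end Multiplicity

/-! ### Minimal reductions are generated by `dim A` elements. -/

section Reduction

open IsLocalRing

/-- The exponents of the monomials of degree `n` in `r` variables. -/
abbrev exponents (r n : ℕ) : Finset (Fin r →₀ ℕ) := Finset.univ.finsuppAntidiag n

theorem prod_pow_mem_pow {A : Type*} [CommRing A] {r : ℕ} {J : Ideal A} {a : Fin r → A}
    (ha : ∀ i, a i ∈ J) (α : Fin r →₀ ℕ) : ∏ i, a i ^ α i ∈ J ^ α.degree := by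
  rw [Finsupp.degree_eq_sum, ← Finset.prod_pow_eq_pow_sum]
  exact Ideal.prod_mem_prod fun i _ => Ideal.pow_mem_pow (ha i) _

/-- Monomials in congruent elements are congruent. -/
theorem prod_pow_sub_prod_pow_mem {A : Type*} [CommRing A] {r : ℕ} {K J : Ideal A}
    {a g : Fin r → A} (ha : ∀ i, a i ∈ J) (hg : ∀ i, g i ∈ J) (hag : ∀ i, a i - g i ∈ K) (n : ℕ)
    (α : Fin r →₀ ℕ) (hα : α.degree = n) :
    ∏ i, a i ^ α i - ∏ i, g i ^ α i ∈ K * J ^ (n - 1) := by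
  classical
  induction n generalizing α with
  | zero =>
    rw [Finsupp.degree_eq_zero_iff] at hα
    simp [hα]
  | succ n ih =>
    obtain ⟨i, hi⟩ : ∃ i, α i ≠ 0 := by
      by_contra! h
      have : α = 0 := Finsupp.ext h
      simp [this] at hα
    obtain ⟨β, rfl⟩ : ∃ β, α = β + Finsupp.single i 1 :=
      ⟨α - Finsupp.single i 1, (tsub_add_cancel_of_le (by
        rw [Finsupp.single_le_iff]
        omega)).symm⟩
    have hβ : β.degree = n := by simpa using hα
    have hprod : ∀ v : Fin r → A,
        ∏ j, v j ^ (β + Finsupp.single i 1 : Fin r →₀ ℕ) j = (∏ j, v j ^ β j) * v i := fun v => by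
      simp only [Finsupp.add_apply, pow_add, Finset.prod_mul_distrib]
      congr 1
      rw [Finset.prod_eq_single i (fun j _ hj => by simp [Finsupp.single_eq_of_ne hj]) (by simp)]
      simp
    rw [hprod, hprod, show ∀ s t u v : A, s * u - t * v = (u - v) * s + (s - t) * v by
      intros; ring]
    refine Ideal.add_mem _ (Ideal.mul_mem_mul (hag i) (hβ ▸ prod_pow_mem_pow ha β)) ?_
    rcases n with _ | n
    · rw [Finsupp.degree_eq_zero_iff] at hβ
      simp [hβ]
    · have := Ideal.mul_mem_mul (ih β hβ) (hg i)
      rwa [mul_assoc, Nat.add_sub_cancel, ← pow_succ] at this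

/-- In the expansion of the n-th power, every term other than `b ^ n` has a factor in `K`. -/
theorem sup_span_pow_le {A : Type*} [CommRing A] (K : Ideal A) (b : A) (n : ℕ) :
    (K ⊔ Ideal.span {b}) ^ n ≤ K * (K ⊔ Ideal.span {b}) ^ (n - 1) ⊔ Ideal.span {b ^ n} := by
  induction n with
  | zero => simp
  | succ n ih =>
    set J := K ⊔ Ideal.span {b} with hJ
    rw [pow_succ]
    refine (Ideal.mul_mono_left ih).trans ?_
    rw [Ideal.sup_mul]
    refine sup_le ?_ ?_
    · rcases n with _ | n
      · exact (show K * J ^ (0 - 1) * J ≤ K * J ^ (0 + 1 - 1) by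
          simpa using Ideal.mul_le_left).trans le_sup_left
      · rw [mul_assoc, Nat.add_sub_cancel, ← pow_succ]
        exact le_sup_left
    · rw [hJ, Ideal.mul_sup, Ideal.span_singleton_mul_span_singleton, ← pow_succ]
      refine sup_le_sup_right ?_ _
      rw [mul_comm, Nat.add_sub_cancel]
      refine Ideal.mul_mono_right ?_
      rw [Ideal.span_singleton_le_iff_mem]
      exact Ideal.pow_mem_pow (Ideal.mem_sup_right (Ideal.mem_span_singleton_self b)) n

variable {A : Type u} [CommRing A] [IsLocalRing A] [IsNoetherianRing A]

/-- Compare `J ^ n` with the ideal of high powers of some system of parameters, whose colength is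
known exactly. -/
theorem IsCohenMacaulayLocal.exists_length_quotient_pow_le (hCM : IsCohenMacaulayLocal A) {d : ℕ}
    (hdim : ringKrullDim A = (d : WithBot ℕ∞)) {J : Ideal A} {M : ℕ}
    (hM : maximalIdeal A ^ M ≤ J) :
    ∃ C : ℕ, ∀ n, n ≠ 0 → Module.length A (A ⧸ J ^ n) ≤ (C * n ^ d : ℕ) := by
  obtain ⟨s, hs, hcard⟩ :=
    (maximalIdeal A).exists_finset_card_eq_height_of_isNoetherianRing
  rw [← maximalIdeal_height_eq_ringKrullDim, ← hcard] at hdim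
  have hd : Fintype.card s = d := by
    rw [Fintype.card_coe]
    exact_mod_cast hdim
  have hx : ∀ i : s, (i : A) ∈ maximalIdeal A := fun i => hs.1.2 (Ideal.subset_span i.2)
  have hprime : ∀ P : Ideal A, P.IsPrime → (∀ i : s, (i : A) ∈ P) → P = maximalIdeal A :=
    fun P hP h => le_antisymm (le_maximalIdeal hP.ne_top)
      (hs.2 ⟨hP, Ideal.span_le.mpr fun a ha => h ⟨a, ha⟩⟩ (le_maximalIdeal hP.ne_top))
  have hdim' : ringKrullDim A = (Fintype.card s : WithBot ℕ∞) := by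
    rw [hd, ← maximalIdeal_height_eq_ringKrullDim, ← hcard]
    exact hdim
  obtain ⟨N, hN⟩ : ∃ N, maximalIdeal A ^ N ≤ Ideal.span (Set.range fun i : s => (i : A)) := by
    refine Ideal.exists_pow_le_of_le_radical_of_fg ?_ (IsNoetherian.noetherian _)
    rw [Ideal.radical_eq_sInf]
    exact le_sInf fun P ⟨hP, hP'⟩ =>
      (hprime P hP' fun i => hP (Ideal.subset_span ⟨i, rfl⟩)).ge
  have hfin : Module.length A (A ⧸ Ideal.span (Set.range fun i : s => (i : A))) ≠ ⊤ :=
    Module.length_ne_top_iff.mpr (isFiniteLength_quotient hN)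
  -- The exponent `M + 1`, rather than `M`, keeps `(M + 1) * n` nonzero even if `M = 0`.
  refine ⟨(M + 1) ^ d *
    (Module.length A (A ⧸ Ideal.span (Set.range fun i : s => (i : A)))).toNat, fun n hn => ?_⟩
  have hle : Ideal.span (Set.range fun i : s => (i : A) ^ ((M + 1) * n)) ≤ J ^ n := by
    rw [Ideal.span_le]
    rintro _ ⟨i, rfl⟩
    dsimp only
    rw [SetLike.mem_coe, pow_mul]
    exact Ideal.pow_mem_pow (hM (Ideal.pow_le_pow_right (Nat.le_succ M)
      (Ideal.pow_mem_pow (hx i) _))) n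
  refine (Module.length_le_of_surjective (Submodule.factor hle)
    (Submodule.factor_surjective hle)).trans ?_
  rw [hCM.length_quotient_span_pow hdim' hx hprime (by positivity), hd, mul_pow,
    ← ENat.natCast_toNat hfin]
  norm_cast
  rw [ENat.toNat_natCast]
  exact le_of_eq (by ring)

/-- If the monomials of degree `n` in the generators of `J` are independent modulo `𝔪 J ^ n`, then
the Hilbert function grows by at least their number. -/
theorem length_add_card_le {A : Type u} [CommRing A] [IsLocalRing A] {r n : ℕ}
    {a : Fin r → A} {J : Ideal A} (ha : ∀ i, a i ∈ J) (hJ : J ≤ maximalIdeal A)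
    (h : ∀ F : exponents r n → A, ∑ α, F α * ∏ i, a i ^ α.1 i ∈ maximalIdeal A * J ^ n →
      ∀ α, F α ∈ maximalIdeal A) :
    (r.multichoose n : ℕ∞) + Module.length A (A ⧸ J ^ n) ≤ Module.length A (A ⧸ J ^ (n + 1)) := by
  classical
  have hle : J ^ (n + 1) ≤ maximalIdeal A * J ^ n := by
    rw [pow_succ']
    exact Ideal.mul_mono_left hJ
  have hle' : maximalIdeal A * J ^ n ≤ J ^ n := Ideal.mul_le_right
  refine le_trans ?_ (Module.length_le_of_surjective (Submodule.factor hle)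
    (Submodule.factor_surjective hle))
  let π : (A ⧸ maximalIdeal A * J ^ n) →ₗ[A] A ⧸ J ^ n := Submodule.factor hle'
  have hmem : ∀ α : exponents r n, ∏ i, a i ^ α.1 i ∈ J ^ n := fun α => by
    have h1 := prod_pow_mem_pow ha α.1
    rwa [Finsupp.degree_eq_sum, (Finset.mem_finsuppAntidiag.mp α.2).1] at h1
  rw [Module.length_eq_add_of_exact (LinearMap.ker π).subtype π
    (LinearMap.ker π).injective_subtype (Submodule.factor_surjective hle')
    (LinearMap.exact_subtype_ker_map π)]
  refine add_le_add_left ?_ _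
  let θ : exponents r n → (A ⧸ maximalIdeal A) →ₗ[A] LinearMap.ker π := fun α =>
    Submodule.liftQ _ (LinearMap.toSpanSingleton A (LinearMap.ker π)
      ⟨Submodule.Quotient.mk (∏ i, a i ^ α.1 i), by
        rw [LinearMap.mem_ker]
        exact (Submodule.Quotient.mk_eq_zero _).mpr (hmem α)⟩) (fun c hc => by
      rw [LinearMap.mem_ker, LinearMap.toSpanSingleton_apply]
      refine Subtype.ext ((Submodule.Quotient.mk_eq_zero _).mpr ?_)
      exact Ideal.mul_mem_mul hc (hmem α))
  let Ψ : (exponents r n → A ⧸ maximalIdeal A) →ₗ[A] LinearMap.ker π :=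
    LinearMap.lsum A (fun _ => A ⧸ maximalIdeal A) A θ
  have hΨ : ∀ F : exponents r n → A, (Ψ fun α => Submodule.Quotient.mk (F α)).1 =
      Submodule.Quotient.mk (∑ α, F α * ∏ i, a i ^ α.1 i) := fun F => by
    rw [show Ψ = LinearMap.lsum A (fun _ => A ⧸ maximalIdeal A) A θ from rfl, LinearMap.lsum_apply,
      LinearMap.sum_apply, AddSubmonoidClass.coe_finsetSum,
      ← Submodule.mkQ_apply, map_sum]
    rfl
  have hinj : Function.Injective Ψ := by
    rw [injective_iff_map_eq_zero]
    intro F' hF'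
    choose F hF using fun α => Submodule.Quotient.mk_surjective _ (F' α)
    obtain rfl : (fun α => Submodule.Quotient.mk (F α)) = F' := funext hF
    have h1 := hΨ F
    rw [hF', ZeroMemClass.coe_zero, eq_comm, Submodule.Quotient.mk_eq_zero] at h1
    funext α
    exact (Submodule.Quotient.mk_eq_zero _).mpr (h F h1 α)
  refine le_trans (le_of_eq ?_) (Module.length_le_of_injective Ψ hinj)
  have : IsSimpleModule A (A ⧸ maximalIdeal A) :=
    isSimpleModule_iff_isCoatom.mpr (maximalIdeal.isMaximal A).out
  rw [Module.length_pi_of_fintype]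
  simp [Finset.card_finsuppAntidiag_nat_eq_multichoose]

/-- Without any relation the Hilbert function of `J` would grow like a polynomial of degree `r`,
against the bound of degree `d < r`. -/
theorem IsCohenMacaulayLocal.exists_relation (hCM : IsCohenMacaulayLocal A) {d : ℕ}
    (hdim : ringKrullDim A = (d : WithBot ℕ∞)) {r : ℕ} (hr : d < r) {a : Fin r → A} {J : Ideal A}
    (ha : ∀ i, a i ∈ J) (hJ : J ≤ maximalIdeal A) {M : ℕ} (hM : maximalIdeal A ^ M ≤ J) :
    ∃ n, ∃ F : exponents r n → A, ∑ α, F α * ∏ i, a i ^ α.1 i ∈ maximalIdeal A * J ^ n ∧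
      ∃ α, F α ∉ maximalIdeal A := by
  by_contra! hcon
  obtain ⟨C, hC⟩ := hCM.exists_length_quotient_pow_le hdim hM
  have hlow : ∀ n : ℕ, (((n + r).choose r : ℕ) : ℕ∞) ≤ Module.length A (A ⧸ J ^ (n + 1)) := by
    intro n
    rw [← Nat.sum_range_multichoose]
    have hsum : ∀ m : ℕ, ((∑ i ∈ Finset.range m, r.multichoose i : ℕ) : ℕ∞) ≤
        Module.length A (A ⧸ J ^ m) := fun m => by
      induction m with
      | zero => simp
      | succ m ih =>
        rw [Finset.sum_range_succ, Nat.cast_add, add_comm]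
        exact (add_le_add_right ih _).trans (length_add_card_le ha hJ (hcon m))
    exact hsum (n + 1)
  have hbound : ∀ n : ℕ, (n + r).choose r ≤ C * (n + 1) ^ d := fun n => by
    exact_mod_cast (hlow n).trans (hC (n + 1) n.succ_ne_zero)
  -- At this `n` the two bounds give `(n + 1) ^ (d + 1) ≤ n * (n + 1) ^ d`.
  have hcontra := hbound (C * r.factorial)
  set n := C * r.factorial with hn
  have h1 : (n + 1) ^ r ≤ r.factorial * (n + r).choose r := by
    rw [← Nat.descFactorial_eq_factorial_mul_choose]
    have := Nat.pow_sub_le_descFactorial (n + r) r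
    rwa [show n + r + 1 - r = n + 1 by omega] at this
  have h2 : (n + 1) ^ (d + 1) ≤ (n + 1) ^ r := Nat.pow_le_pow_right (by omega) hr
  have h3 : (n + 1) ^ (d + 1) ≤ n * (n + 1) ^ d := by
    calc (n + 1) ^ (d + 1) ≤ r.factorial * (n + r).choose r := h2.trans h1
      _ ≤ r.factorial * (C * (n + 1) ^ d) := Nat.mul_le_mul_left _ hcontra
      _ = n * (n + 1) ^ d := by rw [hn]; ring
  rw [pow_succ, mul_comm] at h3
  have := Nat.le_of_mul_le_mul_right h3 (by positivity)
  omega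

/-- A nonzero form over an infinite field does not vanish at some point with a coordinate `1`. -/
theorem exists_sum_prod_pow_notMem {A : Type u} [CommRing A] [IsLocalRing A]
    [Infinite (ResidueField A)] {r n : ℕ} (hn : n ≠ 0)
    {F : exponents r n → A} (hF : ∃ α, F α ∉ maximalIdeal A) :
    ∃ (j : Fin r) (u : Fin r → A), u j = 1 ∧ ∑ α, F α * ∏ i, u i ^ α.1 i ∉ maximalIdeal A := by
  classical
  obtain ⟨β, hβ⟩ := hF
  let f : MvPolynomial (Fin r) (ResidueField A) :=
    ∑ α, MvPolynomial.monomial α.1 (residue A (F α))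
  have hf : f ≠ 0 := fun h0 => hβ (by
    rw [← residue_eq_zero_iff]
    have h1 : MvPolynomial.coeff β.1 f = residue A (F β) := by
      rw [MvPolynomial.coeff_sum, Finset.sum_eq_single β]
      · simp
      · intro α _ hα
        rw [MvPolynomial.coeff_monomial, if_neg fun h => hα (Subtype.ext h)]
      · simp
    rw [← h1, h0, MvPolynomial.coeff_zero])
  have heval : ∀ c, MvPolynomial.eval c f = ∑ α, residue A (F α) * ∏ i, c i ^ α.1 i := fun c => by
    simp only [f, map_sum, MvPolynomial.eval_monomial]
    exact Finset.sum_congr rfl fun α _ => by rw [Finsupp.prod_fintype _ _ (by simp)]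
  obtain ⟨c, hc⟩ : ∃ c, MvPolynomial.eval c f ≠ 0 := by
    by_contra! h
    exact hf (MvPolynomial.funext fun c => by rw [h c, map_zero])
  have hhom : ∀ t : ResidueField A, ∑ α, residue A (F α) * ∏ i, (c i * t) ^ α.1 i =
      MvPolynomial.eval c f * t ^ n := fun t => by
    rw [heval, Finset.sum_mul]
    refine Finset.sum_congr rfl fun α _ => ?_
    simp only [mul_pow, Finset.prod_mul_distrib, Finset.prod_pow_eq_pow_sum]
    rw [(Finset.mem_finsuppAntidiag.mp α.2).1, mul_assoc]
  -- A form of positive degree vanishes at the origin. By homogeneity the point can then be rescaled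
  -- to have `j`-th coordinate `1`.
  obtain ⟨j, hj⟩ : ∃ j, c j ≠ 0 := by
    by_contra! h
    have h0 := hhom 0
    have h1 := hhom 1
    simp only [h, zero_mul] at h0 h1
    rw [h0, zero_pow hn, mul_zero, one_pow, mul_one] at h1
    exact hc h1.symm
  choose v hv using fun i => residue_surjective (c i * (c j)⁻¹)
  refine ⟨j, Function.update v j 1, by simp, ?_⟩
  have hu : ∀ i, residue A (Function.update v j 1 i) = c i * (c j)⁻¹ := fun i => by
    by_cases hi : i = j
    · subst hi
      simp [hj]
    · simp [hi, hv]
  rw [← residue_eq_zero_iff, map_sum]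
  simp only [map_mul, map_prod, map_pow, hu]
  rw [hhom]
  exact mul_ne_zero hc (pow_ne_zero _ (inv_ne_zero hj))

/-- A relation among the monomials in the generators of `J` yields a reduction of `J` with fewer
generators. -/
theorem exists_reduction_of_relation [Infinite (ResidueField A)] {r n : ℕ} {a : Fin (r + 1) → A}
    {J : Ideal A} (hJa : J = Ideal.span (Set.range a)) {F : exponents (r + 1) n → A}
    (hF : ∑ α, F α * ∏ i, a i ^ α.1 i ∈ maximalIdeal A * J ^ n)
    (hF' : ∃ α, F α ∉ maximalIdeal A) :
    ∃ b : Fin r → A, IsReduction (Ideal.span (Set.range b)) J := by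
  classical
  have ha : ∀ i, a i ∈ J := fun i => hJa ▸ Ideal.subset_span ⟨i, rfl⟩
  have hdeg : ∀ α : exponents (r + 1) n, α.1.degree = n := fun α => by
    rw [Finsupp.degree_eq_sum, (Finset.mem_finsuppAntidiag.mp α.2).1]
  have hn : n ≠ 0 := by
    rintro rfl
    obtain ⟨α, hα⟩ := hF'
    have h0 : ∀ β : exponents (r + 1) 0, β.1 = 0 := fun β =>
      (Finsupp.degree_eq_zero_iff _).mp (hdeg β)
    have huniv : (Finset.univ : Finset (exponents (r + 1) 0)) = {α} := by
      ext β
      simpa using Subtype.ext ((h0 β).trans (h0 α).symm)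
    rw [huniv, Finset.sum_singleton, h0 α] at hF
    exact hα (by simpa using hF)
  obtain ⟨j, u, huj, hu⟩ := exists_sum_prod_pow_notMem hn hF'
  -- Modulo `K` every `a i` becomes `u i * a j`, so the relation turns into a unit times `a j ^ n`.
  -- Hence `J ^ n ⊆ K J ^ (n - 1) + 𝔪 J ^ n`, and Nakayama removes the last term.
  let b : Fin r → A := fun i => a (j.succAbove i) - u (j.succAbove i) * a j
  let K := Ideal.span (Set.range b)
  have hbK : ∀ i, a i - u i * a j ∈ K := fun i => by
    rcases Fin.eq_self_or_eq_succAbove j i with rfl | ⟨i, rfl⟩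
    · simp [huj]
    · exact Ideal.subset_span ⟨i, rfl⟩
  have hKJ : K ≤ J := by
    rw [Ideal.span_le]
    rintro _ ⟨i, rfl⟩
    exact J.sub_mem (ha _) (J.mul_mem_left _ (ha _))
  have hJK : J = K ⊔ Ideal.span {a j} := by
    refine le_antisymm ?_ (sup_le hKJ ((Ideal.span_singleton_le_iff_mem _).mpr (ha j)))
    rw [hJa, Ideal.span_le]
    rintro _ ⟨i, rfl⟩
    rw [← sub_add_cancel (a i) (u i * a j)]
    exact Ideal.add_mem _ (Ideal.mem_sup_left (hbK i))
      (Ideal.mem_sup_right (Ideal.mul_mem_left _ _ (Ideal.mem_span_singleton_self _)))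
  have hpow : a j ^ n ∈ K * J ^ (n - 1) ⊔ maximalIdeal A * J ^ n := by
    have hunit : IsUnit (∑ α, F α * ∏ i, u i ^ α.1 i) := by
      rwa [mem_maximalIdeal, mem_nonunits_iff, not_not] at hu
    have hdiff : ∑ α, F α * ∏ i, a i ^ α.1 i - (∑ α, F α * ∏ i, u i ^ α.1 i) * a j ^ n ∈
        K * J ^ (n - 1) := by
      rw [Finset.sum_mul, ← Finset.sum_sub_distrib]
      refine Ideal.sum_mem _ fun α _ => ?_
      have h1 := prod_pow_sub_prod_pow_mem ha (fun i => J.mul_mem_left (u i) (ha j)) hbK n α.1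
        (hdeg α)
      simp only [mul_pow, Finset.prod_mul_distrib, Finset.prod_pow_eq_pow_sum] at h1
      rw [← Finsupp.degree_eq_sum, hdeg] at h1
      rw [mul_assoc, ← mul_sub]
      exact Ideal.mul_mem_left _ _ h1
    rw [← Ideal.unit_mul_mem_iff_mem _ hunit]
    have h2 := Ideal.sub_mem _ (Ideal.mem_sup_right (S := K * J ^ (n - 1)) hF)
      (Ideal.mem_sup_left hdiff)
    rwa [sub_sub_cancel] at h2
  have hle : J ^ n ≤ K * J ^ (n - 1) ⊔ maximalIdeal A • J ^ n := by
    have h1 := sup_span_pow_le K (a j) n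
    rw [← hJK] at h1
    exact h1.trans (sup_le le_sup_left ((Ideal.span_singleton_le_iff_mem _).mpr hpow))
  have hle' : J ^ n ≤ K * J ^ (n - 1) :=
    Submodule.le_of_le_smul_of_le_jacobson_bot (IsNoetherian.noetherian _)
      (jacobson_eq_maximalIdeal ⊥ bot_ne_top).ge hle
  refine ⟨b, hKJ, n - 1, ?_⟩
  rw [Nat.sub_add_cancel (Nat.pos_of_ne_zero hn)]
  refine le_antisymm hle' ((Ideal.mul_mono_left hKJ).trans ?_)
  rw [← pow_succ', Nat.sub_add_cancel (Nat.pos_of_ne_zero hn)]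

theorem IsReduction.trans {A : Type u} [CommRing A] {K J I : Ideal A} (hKJ : IsReduction K J)
    (hJI : IsReduction J I) : IsReduction K I := by
  obtain ⟨hKJ, m, hm⟩ := hKJ
  obtain ⟨hJI, n, hn⟩ := hJI
  refine ⟨hKJ.trans hJI, n + m, ?_⟩
  rw [add_assoc, Ideal.pow_add_eq_of_reduction hn, Ideal.pow_add_eq_of_reduction hn, hm, mul_assoc]

/-- Over an infinite residue field, minimal reductions of primary ideals are generated by `dim A`
elements. -/
theorem IsMinimalReduction.exists_eq_span_range [Infinite (ResidueField A)]
    (hCM : IsCohenMacaulayLocal A) {d : ℕ} (hdim : ringKrullDim A = (d : WithBot ℕ∞))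
    {J I : Ideal A} (hJI : IsMinimalReduction J I) (hJ : J ≤ maximalIdeal A) {M : ℕ}
    (hM : maximalIdeal A ^ M ≤ J) : ∃ x : Fin d → A, J = Ideal.span (Set.range x) := by
  have key : ∀ r, (∃ a : Fin r → A, J = Ideal.span (Set.range a)) →
      ∃ x : Fin d → A, J = Ideal.span (Set.range x) := by
    intro r
    induction r with
    | zero =>
      rintro ⟨a, ha⟩
      refine ⟨0, ?_⟩
      rw [ha, Set.range_eq_empty, Ideal.span_empty, eq_comm, Ideal.span_eq_bot]
      rintro _ ⟨i, rfl⟩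
      rfl
    | succ r ih =>
      rintro ⟨a, ha⟩
      by_cases hr : r + 1 ≤ d
      -- With at most `d` generators, pad the family by zeros.
      · refine ⟨fun i => if h : (i : ℕ) < r + 1 then a ⟨i, h⟩ else 0, ha.trans ?_⟩
        refine le_antisymm (Ideal.span_le.mpr ?_) (Ideal.span_le.mpr ?_)
        · rintro _ ⟨i, rfl⟩
          exact Ideal.subset_span ⟨⟨i, by omega⟩, dif_pos i.2⟩
        · rintro _ ⟨i, rfl⟩
          dsimp only
          split_ifs with h
          · exact Ideal.subset_span ⟨_, rfl⟩
          · exact Ideal.zero_mem _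
      · obtain ⟨n, F, hF, hF'⟩ := hCM.exists_relation hdim (not_le.mp hr)
          (fun i => ha.ge (Ideal.subset_span (Set.mem_range_self i))) hJ hM
        obtain ⟨b, hb⟩ := exists_reduction_of_relation ha hF hF'
        -- The smaller ideal is a reduction of `I` by transitivity, so minimality makes it equal to
        -- `J`.
        exact ih ⟨b, le_antisymm (hJI.2 (hb.trans hJI.1) hb.1) hb.1⟩
  obtain ⟨r, a, ha⟩ := Submodule.fg_iff_exists_fin_generating_family.mp
    (IsNoetherian.noetherian J)
  exact key r ⟨a, ha.symm⟩

end Reduction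

/-! ### The main inequality. -/

theorem mainTheorem12 {A : Type u} [CommRing A] [IsLocalRing A] [IsNoetherianRing A]
    (p : ℕ) [Fact p.Prime] [CharP A p] (hCM : IsCohenMacaulayLocal A)
    (d : ℕ) (hd : 1 ≤ d) (hdim : ringKrullDim A = (d : WithBot ℕ∞))
    (I J : Ideal A) (hI : I.radical = IsLocalRing.maximalIdeal A)
    (hJ : IsMinimalReduction J I)
    (hgen : Infinite (IsLocalRing.ResidueField A) ∨
      ∃ x : Fin d → A, J = Ideal.span (Set.range x))
    (hIJ : I ^ 2 ≤ J) :
    Tendsto (multiplicitySeq d I) atTop (𝓝 (idealMultiplicity d I)) ∧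
      Tendsto (hilbertKunzSeq p d I) atTop (𝓝 (hilbertKunzMultiplicity p d I)) ∧
      idealMultiplicity d I / 2 ≤ hilbertKunzMultiplicity p d I := by
  have hJI : J ≤ I := hJ.1.1
  have hIm : I ≤ IsLocalRing.maximalIdeal A := hI ▸ Ideal.le_radical
  obtain ⟨M, hM⟩ := Ideal.exists_pow_le_of_le_radical_of_fg hI.ge (IsNoetherian.noetherian _)
  -- That `J` is primary to the maximal ideal comes directly from `I ^ 2 ≤ J`.
  have hMJ : IsLocalRing.maximalIdeal A ^ (M * 2) ≤ J := by
    rw [pow_mul]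
    exact (Ideal.pow_right_mono hM 2).trans hIJ
  obtain ⟨x, rfl⟩ : ∃ x : Fin d → A, J = Ideal.span (Set.range x) :=
    hgen.elim (fun _ => hJ.exists_eq_span_range hCM hdim (hJI.trans hIm) hMJ) id
  have hx : ∀ i, x i ∈ IsLocalRing.maximalIdeal A := fun i =>
    hIm (hJI (Ideal.subset_span ⟨i, rfl⟩))
  obtain ⟨L, hL, hle⟩ := hCM.exists_tendsto_hilbertKunzSeq p hd hdim hx hMJ hJI hIJ
  have he := hCM.tendsto_multiplicitySeq p hdim hx hMJ hJ.1
  rw [hilbertKunzMultiplicity, idealMultiplicity, he.limUnder_eq, hL.limUnder_eq]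
  exact ⟨he, hL, hle⟩
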